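/- Let $A=(Q,q_0,O,R,\sigma)$ be any sequential object with a total deterministic transition function $\sigma:O\times Q\to R\times Q$, and let $n$ processes share arrays of atomic registers $S[1..n]$ (initially $(0,\epsilon)$) and $M[1..n]$ (initially $\bot$) and a sequence of generalized commit-adopt objects $\mathrm{GCA}_1,\mathrm{GCA}_2,\dots$. Two operations conflict if in some state they do not commute (executing them in the two orders does not give the same two responses and the same final state). A command is a triple $(op,i,seq)$ and acts and conflicts as $op$ does. Two finite sequences of commands (schedules) are equivalent if they have the same multiset of commands and order all conflicting occurrences in the same way; the classes are called traces. Write $x\le y$ if $y=x\cdot z$ for some trace $z$; traces are compatible if they have a common upper bound; $\mathrm{ret}^*(cmd,u)$ is the response of $cmd$ when a representative of $u$ is executed from $q_0$. A GCA object has one operation $\mathrm{propose}(s)$, which returns a trace $t$ together with a flag $c$ (true: $t$ is committed; false: $t$ is adopted). In every finite execution its calls (the participants) satisfy: (Validity) the multiset of commands of each output is contained in the union of those of the inputs; (Adoption) every output extends every committed output; (Commitment) if there is a call, the inputs are compatible and all calls have returned, then some call commits an extension of its input; (Convergence) the outputs are compatible; (Common prefix) every output extends the greatest lower bound of the inputs;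 (Weak agreement) if all inputs are equal, every output is committed. The conflict-free universal construction is the following code of process $i$ (initially $seq=0$) for $\mathrm{invoke}(op)$: 1. $seq\gets seq+1$; $cmd\gets(op,i,seq)$; $M[i]\gets cmd$; read $S[1..n]$ and let $(r,s)$ be an entry with the largest round; $u\gets\epsilon$. 2. While $cmd$ does not occur in $u$: $r\gets r+1$; read $M[1..n]$ and append to $s$, in any order, the commands found there that do not occur in $s$; $(s,c)\gets\mathrm{GCA}_r.\mathrm{propose}(s)$; if $c$ is true, $S[i]\gets(r,s)$; read $S[1..n]$ and let $u$ be the trace of an entry with the largest round. 3. Return $\mathrm{ret}^*(cmd,u)$. Then this algorithm is a linearizable implementation of $A$: the history of invocations and responses of every finite or infinite asynchronous execution is linearizable with respect to $A$. Moreover, for every finite execution, let $t$ be the trace committed in the largest round in which some trace is committed ($t=\epsilon$ if there is none). Then some representative $\hat t$ of $t$ is such that each command in $\hat t$ belongs to an operation invoked in the execution, and the sequence of these operations in the order of $\hat t$, with the responses $\mathrm{ret}^*(\cdot,\hat t)$, is a linearization of the history; in particular it respects the real-time order and contains every completed operation with the response that it returned. -/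

import Mathlib

universe u v w

/-! ### Sequential objects, commutation and conflicts -/

/-- A sequential data type `(Q, q₀, O, R, σ)` with operations `O`, states `Q` and responses `R`;
`init` is `q₀` and `step o q` is `σ (o, q)`. -/
structure SeqObject (O : Type u) (Q : Type v) (R : Type w) where
  init : Q
  step : O → Q → R × Q

namespace SeqObject

variable {O : Type u} {Q : Type v} {R : Type w} (A : SeqObject O Q R)

/-- `a` and `b` commute in the state `q`. -/
def CommuteIn (q : Q) (a b : O) : Prop :=
  ∃ (ra rb : R) (q₁ q₂ q' : Q),
    A.step a q = (ra, q₁) ∧ A.step b q₁ = (rb, q') ∧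
    A.step b q = (rb, q₂) ∧ A.step a q₂ = (ra, q')

/-- Two operations conflict if they fail to commute in some state. -/
def Conflict (a b : O) : Prop := ∃ q, ¬ A.CommuteIn q a b

theorem Conflict.symm {a b : O} (h : A.Conflict a b) : A.Conflict b a := by
  obtain ⟨q, hq⟩ := h
  refine ⟨q, fun hc => hq ?_⟩
  obtain ⟨rb, ra, q₁, q₂, q', h1, h2, h3, h4⟩ := hc
  exact ⟨ra, rb, q₂, q₁, q', h3, h4, h1, h2⟩

/-- `σ*`: the sequence of (response, resulting state) pairs when a schedule is executed. -/
def run : List O → Q → List (R × Q)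
  | [], _ => []
  | o :: s, q => A.step o q :: run s (A.step o q).2

end SeqObject

/-! ### Schedules and traces -/

section Schedules

variable {O : Type u} {Q : Type v} {R : Type w}

open Classical in
/-- Position `k` of the schedule `s` holds the occurrence number `i` of `a`
(occurrences and positions are numbered from `0`). -/
def OccAt (s : List O) (a : O) (i k : ℕ) : Prop :=
  s[k]? = some a ∧ (s.take k).count a = i

/-- In `s`, occurrence `i` of `a` strictly precedes occurrence `j` of `b`. -/
def OccPrec (s : List O) (a : O) (i : ℕ) (b : O) (j : ℕ) : Prop :=
  ∃ k l, k < l ∧ OccAt s a i k ∧ OccAt s b j l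

/-- Equivalence of schedules: the same multiset of operations, and the order of conflicting
occurrences is preserved. -/
def SchedEquiv (A : SeqObject O Q R) (s s' : List O) : Prop :=
  (s : Multiset O) = (s' : Multiset O) ∧
  ∀ a i b j, A.Conflict a b → OccPrec s a i b j → OccPrec s' a i b j

open Classical in
theorem OccAt.lt_count {s : List O} {a : O} {i k : ℕ} (h : OccAt s a i k) :
    i < s.count a := by
  obtain ⟨h1, h2⟩ := h
  have h3 : s.count a = (s.take k).count a + (s.drop k).count a := by
    rw [← List.count_append, List.take_append_drop]
  have hk : k < s.length := by
    by_contra hc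
    rw [List.getElem?_eq_none (by omega)] at h1
    cases h1
  rw [List.drop_eq_getElem_cons hk] at h3
  rw [List.getElem?_eq_getElem hk, Option.some.injEq] at h1
  rw [h1, List.count_cons_self] at h3
  omega

open Classical in
theorem exists_occAt {s : List O} {a : O} {i : ℕ} (h : i < s.count a) :
    ∃ k, OccAt s a i k := by
  induction s generalizing i with
  | nil => simp at h
  | cons x s ih =>
    by_cases hx : x = a
    · subst hx
      rw [List.count_cons_self] at h
      rcases i with _ | i
      · exact ⟨0, by simp [OccAt]⟩
      · obtain ⟨k, hk1, hk2⟩ := ih (i := i) (by omega)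
        exact ⟨k + 1, by simpa using hk1, by simpa using hk2⟩
    · rw [List.count_cons_of_ne hx] at h
      obtain ⟨k, hk1, hk2⟩ := ih h
      exact ⟨k + 1, by simpa using hk1, by
        rw [List.take_succ_cons, List.count_cons_of_ne hx]; exact hk2⟩

open Classical in
theorem OccAt.lt_of_lt {s : List O} {a : O} {i j k l : ℕ} (h : OccAt s a i k)
    (h' : OccAt s a j l) (hkl : k < l) : i < j := by
  have : OccAt (s.take l) a i k := by
    refine ⟨?_, ?_⟩
    · rw [List.getElem?_take_of_lt hkl]; exact h.1
    · rw [List.take_take, min_eq_left hkl.le]; exact h.2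
  have h2 := this.lt_count
  have h3 : (s.take l).count a = j := h'.2
  omega

theorem OccAt.unique {s : List O} {a : O} {i k l : ℕ} (h : OccAt s a i k)
    (h' : OccAt s a i l) : k = l := by
  rcases lt_trichotomy k l with hlt | heq | hgt
  · exact absurd (h.lt_of_lt h' hlt) (lt_irrefl _)
  · exact heq
  · exact absurd (h'.lt_of_lt h hgt) (lt_irrefl _)

open Classical in
theorem occAt_append {s t : List O} {a : O} {i k : ℕ} :
    OccAt (s ++ t) a i k ↔
      (k < s.length ∧ OccAt s a i k) ∨
      (∃ i' k', k = s.length + k' ∧ i = s.count a + i' ∧ OccAt t a i' k') := by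
  constructor
  · rintro ⟨h1, h2⟩
    by_cases hk : k < s.length
    · left
      rw [List.getElem?_append_left hk] at h1
      rw [List.take_append_of_le_length hk.le] at h2
      exact ⟨hk, h1, h2⟩
    · right
      obtain ⟨k', rfl⟩ := Nat.exists_eq_add_of_le (not_lt.mp hk)
      rw [List.getElem?_append_right (by omega), Nat.add_sub_cancel_left] at h1
      rw [List.take_length_add_append, List.count_append] at h2
      exact ⟨_, k', rfl, h2.symm, h1, rfl⟩
  · rintro (⟨hk, h1, h2⟩ | ⟨i', k', rfl, rfl, h1, h2⟩)
    · refine ⟨?_, ?_⟩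
      · rw [List.getElem?_append_left hk]; exact h1
      · rw [List.take_append_of_le_length hk.le]; exact h2
    · refine ⟨?_, ?_⟩
      · rw [List.getElem?_append_right (by omega), Nat.add_sub_cancel_left]; exact h1
      · rw [List.take_length_add_append, List.count_append, h2]

open Classical in
theorem SchedEquiv.count_eq {A : SeqObject O Q R} {s s' : List O}
    (h : SchedEquiv A s s') (a : O) : s.count a = s'.count a :=
  (Multiset.coe_eq_coe.mp h.1).count_eq a

theorem SchedEquiv.refl (A : SeqObject O Q R) (s : List O) : SchedEquiv A s s :=
  ⟨rfl, fun _ _ _ _ _ h => h⟩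

open Classical in
theorem SchedEquiv.symm {A : SeqObject O Q R} {s s' : List O} (h : SchedEquiv A s s') :
    SchedEquiv A s' s := by
  refine ⟨h.1.symm, ?_⟩
  rintro a i b j hab ⟨k', l', hkl', hk', hl'⟩
  obtain ⟨k, hk⟩ := exists_occAt (by rw [h.count_eq a]; exact hk'.lt_count)
  obtain ⟨l, hl⟩ := exists_occAt (by rw [h.count_eq b]; exact hl'.lt_count)
  rcases lt_trichotomy k l with hlt | heq | hgt
  · exact ⟨k, l, hlt, hk, hl⟩
  · subst heq
    have hab' : a = b := by
      have := hk.1.symm.trans hl.1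
      simpa using this
    subst hab'
    have hij : i = j := hk.2.symm.trans hl.2
    subst hij
    exact absurd (hk'.unique hl') (by omega)
  · obtain ⟨l₂, k₂, hlk, hl₂, hk₂⟩ := h.2 b j a i hab.symm ⟨l, k, hgt, hl, hk⟩
    have e1 := hk₂.unique hk'
    have e2 := hl₂.unique hl'
    omega

theorem SchedEquiv.trans {A : SeqObject O Q R} {s s' s'' : List O} (h : SchedEquiv A s s')
    (h' : SchedEquiv A s' s'') : SchedEquiv A s s'' :=
  ⟨h.1.trans h'.1, fun a i b j hab hp => h'.2 a i b j hab (h.2 a i b j hab hp)⟩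

open Classical in
theorem SchedEquiv.append {A : SeqObject O Q R} {s s' t t' : List O} (h : SchedEquiv A s s')
    (h' : SchedEquiv A t t') : SchedEquiv A (s ++ t) (s' ++ t') := by
  refine ⟨?_, ?_⟩
  · rw [← Multiset.coe_add, ← Multiset.coe_add, h.1, h'.1]
  rintro a i b j hab ⟨k, l, hkl, hk, hl⟩
  rw [occAt_append] at hk hl
  rcases hk with ⟨hks, hk⟩ | ⟨i', k', rfl, rfl, hk⟩
  · rcases hl with ⟨hls, hl⟩ | ⟨j', l', rfl, rfl, hl⟩
    · obtain ⟨k₂, l₂, hlt, hk₂, hl₂⟩ := h.2 a i b j hab ⟨k, l, hkl, hk, hl⟩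
      have hlen : l₂ < s'.length := by
        by_contra hc
        have := hl₂.1
        rw [List.getElem?_eq_none (by omega)] at this
        cases this
      exact ⟨k₂, l₂, hlt, occAt_append.mpr (Or.inl ⟨by omega, hk₂⟩),
        occAt_append.mpr (Or.inl ⟨hlen, hl₂⟩)⟩
    · obtain ⟨k₂, hk₂⟩ := exists_occAt (by rw [← h.count_eq a]; exact hk.lt_count)
      obtain ⟨l₂, hl₂⟩ := exists_occAt (by rw [← h'.count_eq b]; exact hl.lt_count)
      have hlen : k₂ < s'.length := by
        by_contra hc
        have := hk₂.1
        rw [List.getElem?_eq_none (by omega)] at this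
        cases this
      exact ⟨k₂, s'.length + l₂, by omega, occAt_append.mpr (Or.inl ⟨hlen, hk₂⟩),
        occAt_append.mpr (Or.inr ⟨j', l₂, rfl, by rw [h.count_eq b], hl₂⟩)⟩
  · rcases hl with ⟨hls, hl⟩ | ⟨j', l', rfl, rfl, hl⟩
    · omega
    · obtain ⟨k₂, l₂, hlt, hk₂, hl₂⟩ := h'.2 a i' b j' hab ⟨k', l', by omega, hk, hl⟩
      exact ⟨s'.length + k₂, s'.length + l₂, by omega,
        occAt_append.mpr (Or.inr ⟨i', k₂, rfl, by rw [h.count_eq a], hk₂⟩),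
        occAt_append.mpr (Or.inr ⟨j', l₂, rfl, by rw [h.count_eq b], hl₂⟩)⟩

/-- Schedules up to equivalence. -/
def schedSetoid (A : SeqObject O Q R) : Setoid (List O) where
  r := SchedEquiv A
  iseqv := ⟨SchedEquiv.refl A, SchedEquiv.symm, SchedEquiv.trans⟩

/-- A trace of `A`: an equivalence class of schedules. -/
def Trace (A : SeqObject O Q R) : Type u := Quotient (schedSetoid A)

end Schedules

namespace Trace

variable {O : Type u} {Q : Type v} {R : Type w} {A : SeqObject O Q R}

/-- The trace `[s]` of a schedule `s`; thus `s` is a representative of `t` iff `mk s = t`. -/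
def mk (s : List O) : Trace A := Quotient.mk (schedSetoid A) s

/-- The empty trace. -/
def empty : Trace A := mk []

/-- Concatenation of traces: `[s] · [s'] = [s · s']`. -/
def append : Trace A → Trace A → Trace A :=
  Quotient.map₂ (· ++ ·) fun _ _ h _ _ h' => SchedEquiv.append h h'

/-- The multiset of operations of a trace. -/
def ops : Trace A → Multiset O :=
  Quotient.lift (fun s : List O => (s : Multiset O)) fun _ _ h => h.1

/-- The prefix order: `x ≤ y` iff `y = x · z` for some `z`. -/
instance : LE (Trace A) := ⟨fun x y => ∃ z, y = x.append z⟩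

end Trace

/-- `r` is the return value, in the schedule `s` executed from the initial state, of the first
occurrence of `a`. -/
def SchedRet {O : Type u} {Q : Type v} {R : Type w} (A : SeqObject O Q R)
    (s : List O) (a : O) (r : R) : Prop :=
  ∃ k q, OccAt s a 0 k ∧ (A.run s A.init)[k]? = some (r, q)

/-- `r` is the return value of the first occurrence of `a` in the trace `t`, evaluated on a
representative of `t`. -/
def Trace.Ret {O : Type u} {Q : Type v} {R : Type w} {A : SeqObject O Q R}
    (t : Trace A) (a : O) (r : R) : Prop :=
  ∃ s : List O, Trace.mk s = t ∧ SchedRet A s a r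

/-! ### Histories and linearizability -/

/-- Invocation and response events of `n` processes. -/
inductive Event (n : ℕ) (O : Type u) (R : Type w) where
  | inv (i : Fin n) (o : O)
  | res (i : Fin n) (r : R)

/-- The process of an event. -/
def Event.proc {n : ℕ} {O : Type u} {R : Type w} : Event n O R → Fin n
  | .inv i _ => i
  | .res i _ => i

/-- A finite or infinite history, indexed by time: `H k` is the event that happens at time `k`,
if there is one.  An operation instance of `H` is identified with the time of its invocation. -/
abbrev History (n : ℕ) (O : Type u) (R : Type w) := ℕ → Option (Event n O R)

namespace History

variable {n : ℕ} {O : Type u} {Q : Type v} {R : Type w}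

/-- The operation instance invoked at time `x` completes at time `k` with response `r`: the next
event of its process after `x` takes place at time `k` and is the response `r`. -/
def CompletesAt (H : History n O R) (x k : ℕ) (r : R) : Prop :=
  ∃ i o, H x = some (.inv i o) ∧ x < k ∧ H k = some (.res i r) ∧
    ∀ l, x < l → l < k → ∀ e, H l = some e → e.proc ≠ i

/-- The finite or infinite sequence `L` of pairs (operation instance, response) is a linearization
of `H` for the sequential object `A`. -/
structure IsLinearization (A : SeqObject O Q R) (H : History n O R)
    (L : Stream'.Seq (ℕ × R)) : Prop where
  /-- Only operation instances of `H` occur (complete ones and some of the pending ones) ... -/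
  isInstance : ∀ m x r, L.get? m = some (x, r) → ∃ i o, H x = some (.inv i o)
  /-- ... and none occurs twice. -/
  distinct : ∀ m m' x r r', L.get? m = some (x, r) → L.get? m' = some (x, r') → m = m'
  /-- Every complete instance occurs, with the response it has in `H`. -/
  complete : ∀ x k r, H.CompletesAt x k r → ∃ m, L.get? m = some (x, r)
  /-- An instance that completes before another one is invoked comes first. -/
  realTime : ∀ m m' x y r r' k r'', L.get? m = some (x, r) → L.get? m' = some (y, r') →
    H.CompletesAt x k r'' → k < y → m < m'
  /-- The sequence is a correct sequential history of `A`. -/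
  legal : ∃ q : ℕ → Q, q 0 = A.init ∧
    ∀ m x r i o, L.get? m = some (x, r) → H x = some (.inv i o) →
      A.step o (q m) = (r, q (m + 1))

/-- `H` is linearizable with respect to the sequential specification `A`. -/
def Linearizable (A : SeqObject O Q R) (H : History n O R) : Prop :=
  ∃ L : Stream'.Seq (ℕ × R), IsLinearization A H L

/-- The history of the events before time `k`. -/
def upTo (H : History n O R) (k : ℕ) : History n O R := fun m => if m < k then H m else none

end History

/-! ### Commands -/

/-- A command `(op, i, seq)`. -/
structure Command (n : ℕ) (O : Type u) where
  op : O
  proc : Fin n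
  seq : ℕ

/-- The object `A_c` on commands derived from `A`: a command acts as its operation. -/
def SeqObject.onCommands {O : Type u} {Q : Type v} {R : Type w} (A : SeqObject O Q R) (n : ℕ) :
    SeqObject (Command n O) Q R where
  init := A.init
  step c q := A.step c.op q

open Classical in
/-- `x` is the time at which `H` has the invocation that belongs to the command
`c = (op, i, seq)`: the invocation number `seq` (counted from 1) of process `i`. -/
def History.InvokesAt {n : ℕ} {O : Type u} {R : Type w} (H : History n O R) (c : Command n O)
    (x : ℕ) : Prop :=
  H x = some (.inv c.proc c.op) ∧
  c.seq = ((Finset.range x).filter fun y => ∃ o, H y = some (.inv c.proc o)).card + 1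

/-- Traces of commands. -/
abbrev CTrace {O : Type u} {Q : Type v} {R : Type w} (A : SeqObject O Q R) (n : ℕ) :=
  Trace (A.onCommands n)

/-! ### Generalized commit-adopt -/

/-- A call of `propose` on a GCA object over the traces `T`; the output is `none` as long as the
call has not returned, and `some (t, c)` after it has returned `(t, c)` (`c = true`: commit). -/
structure GCACall (T : Type u) where
  input : T
  output : Option (T × Bool)

/-- The specification of GCA, for the calls made on an object so far (the participants) and their
outputs. -/
structure GCASpec {O : Type u} {Q : Type v} {R : Type w} {A : SeqObject O Q R}
    (P : List (GCACall (Trace A))) : Prop where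
  /-- Output traces contain only input operations. The union of multisets takes the maximum of the
  multiplicities. -/
  validity : open Classical in ∀ p ∈ P, ∀ t c, p.output = some (t, c) →
    t.ops ≤ (P.map fun q => q.input.ops).foldr (fun X Y => X ∪ Y) 0
  /-- A committed trace is extended by every output trace. -/
  adoption : ∀ p ∈ P, ∀ t, p.output = some (t, true) →
    ∀ q ∈ P, ∀ t' c, q.output = some (t', c) → t ≤ t'
  /-- If the inputs are compatible and all calls have returned, some call commits an extension of
  its input. -/
  commitment : P ≠ [] → BddAbove {s | ∃ p ∈ P, p.input = s} → (∀ p ∈ P, p.output ≠ none) →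
    ∃ p ∈ P, ∃ t, p.output = some (t, true) ∧ p.input ≤ t
  /-- Output traces are compatible. -/
  convergence : BddAbove {t | ∃ p ∈ P, ∃ c, p.output = some (t, c)}
  /-- Output traces extend the greatest lower bound of the input traces. -/
  commonPrefix : ∀ g, IsGLB {s | ∃ p ∈ P, p.input = s} g →
    ∀ p ∈ P, ∀ t c, p.output = some (t, c) → g ≤ t
  /-- If all inputs are equal, every output is committed. -/
  weakAgreement : (∀ p ∈ P, ∀ q ∈ P, p.input = q.input) →
    ∀ p ∈ P, ∀ t c, p.output = some (t, c) → c = true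

/-! ### The conflict-free universal construction -/

namespace UC

variable {O : Type u} {Q : Type v} {R : Type w}

/-- Control state of a process, together with the values of its local variables.
In the collects, `view j` is the value read from the register of `j`, `none` if it has not been
read yet. -/
inductive Control (A : SeqObject O Q R) (n : ℕ) where
  /-- no operation is pending -/
  | idle
  /-- about to execute `M[i] ← cmd` -/
  | announce (cmd : Command n O)
  /-- reading `S[1..n]`, before the loop -/
  | readS (cmd : Command n O) (view : Fin n → Option (ℕ × CTrace A n))
  /-- in round `r`, reading `M[1..n]` -/
  | readM (cmd : Command n O) (r : ℕ) (s : CTrace A n)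
      (view : Fin n → Option (Option (Command n O)))
  /-- about to call `GCA_r.propose(s)` -/
  | propose (cmd : Command n O) (r : ℕ) (s : CTrace A n)
  /-- waiting for the response to the call number `id` on `GCA_r` -/
  | await (cmd : Command n O) (r : ℕ) (id : ℕ)
  /-- `GCA_r` has committed `s`: about to execute `S[i] ← (r, s)` -/
  | writeS (cmd : Command n O) (r : ℕ) (s : CTrace A n)
  /-- reading `S[1..n]` at the end of round `r` -/
  | rereadS (cmd : Command n O) (r : ℕ) (s : CTrace A n)
      (view : Fin n → Option (ℕ × CTrace A n))

/-- Configurations: the control state and the sequence counter of every process, the registers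
`M` and `S`, and for every round `r` the calls made on `GCA_r` so far. -/
structure Config (A : SeqObject O Q R) (n : ℕ) where
  ctrl : Fin n → Control A n
  seq : Fin n → ℕ
  M : Fin n → Option (Command n O)
  S : Fin n → ℕ × CTrace A n
  gca : ℕ → List (GCACall (CTrace A n))

/-- The initial configuration. -/
def Config.initial (A : SeqObject O Q R) (n : ℕ) : Config A n where
  ctrl := fun _ => .idle
  seq := fun _ => 0
  M := fun _ => none
  S := fun _ => (0, Trace.empty)
  gca := fun _ => []

/-- Process `i` moves to the control state `p`. -/
def Config.goto {A : SeqObject O Q R} {n : ℕ} (C : Config A n) (i : Fin n) (p : Control A n) :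
    Config A n :=
  { C with ctrl := Function.update C.ctrl i p }

/-- All registers of `S` have been read, and `(r, s)` is one of the values with the largest
round. -/
def IsMax {A : SeqObject O Q R} {n : ℕ} (view : Fin n → Option (ℕ × CTrace A n))
    (r : ℕ) (s : CTrace A n) : Prop :=
  (∀ j, view j ≠ none) ∧ (∃ j, view j = some (r, s)) ∧
    ∀ j r' s', view j = some (r', s') → r' ≤ r

/-- All registers of `M` have been read, and `l` lists in some order, without repetition, the
commands found there that do not occur in `s`. -/
def IsMissing {A : SeqObject O Q R} {n : ℕ} (view : Fin n → Option (Option (Command n O)))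
    (s : CTrace A n) (l : List (Command n O)) : Prop :=
  (∀ j, view j ≠ none) ∧ l.Nodup ∧
    ∀ c, c ∈ l ↔ (∃ j, view j = some (some c)) ∧ c ∉ s.ops

/-- `Step C e C'`: some process takes one step of the algorithm from `C` to `C'`, with at most one
access to a shared object; `e` is the event of the history that it produces, if any. The
registers of an array are read one at a time, in any order. -/
inductive Step {A : SeqObject O Q R} {n : ℕ} :
    Config A n → Option (Event n O R) → Config A n → Prop
  /-- `invoke(o)`: `seq ← seq + 1`, `cmd ← (o, i, seq)` -/
  | invoke (C : Config A n) (i : Fin n) (o : O) (h : C.ctrl i = .idle) :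
      Step C (some (.inv i o))
        { C.goto i (.announce ⟨o, i, C.seq i + 1⟩) with
          seq := Function.update C.seq i (C.seq i + 1) }
  /-- `M[i] ← cmd` -/
  | announce (C : Config A n) (i : Fin n) (cmd : Command n O)
      (h : C.ctrl i = .announce cmd) :
      Step C none
        { C.goto i (.readS cmd fun _ => none) with M := Function.update C.M i (some cmd) }
  /-- read `S[j]` -/
  | readS (C : Config A n) (i j : Fin n) (cmd : Command n O)
      (view : Fin n → Option (ℕ × CTrace A n))
      (h : C.ctrl i = .readS cmd view) (hj : view j = none) :
      Step C none (C.goto i (.readS cmd (Function.update view j (some (C.S j)))))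
  /-- `(r, s) ← max S`, `u ← ε`; enter the loop, `r ← r + 1` -/
  | enter (C : Config A n) (i : Fin n) (cmd : Command n O)
      (view : Fin n → Option (ℕ × CTrace A n)) (r : ℕ) (s : CTrace A n)
      (h : C.ctrl i = .readS cmd view) (hmax : IsMax view r s) :
      Step C none (C.goto i (.readM cmd (r + 1) s fun _ => none))
  /-- read `M[j]` -/
  | readM (C : Config A n) (i j : Fin n) (cmd : Command n O) (r : ℕ) (s : CTrace A n)
      (view : Fin n → Option (Option (Command n O)))
      (h : C.ctrl i = .readM cmd r s view) (hj : view j = none) :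
      Step C none (C.goto i (.readM cmd r s (Function.update view j (some (C.M j)))))
  /-- `s ← s · trace(M_i)` -/
  | extend (C : Config A n) (i : Fin n) (cmd : Command n O) (r : ℕ) (s : CTrace A n)
      (view : Fin n → Option (Option (Command n O))) (l : List (Command n O))
      (h : C.ctrl i = .readM cmd r s view) (hl : IsMissing view s l) :
      Step C none (C.goto i (.propose cmd r (s.append (Trace.mk l))))
  /-- call `GCA_r.propose(s)` -/
  | propose (C : Config A n) (i : Fin n) (cmd : Command n O) (r : ℕ) (s : CTrace A n)
      (h : C.ctrl i = .propose cmd r s) :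
      Step C none
        { C.goto i (.await cmd r (C.gca r).length) with
          gca := Function.update C.gca r (C.gca r ++ [⟨s, none⟩]) }
  /-- `GCA_r` returns `(t, c)`; test `c` -/
  | respond (C : Config A n) (i : Fin n) (cmd : Command n O) (r id : ℕ) (s t : CTrace A n)
      (c : Bool) (h : C.ctrl i = .await cmd r id) (hid : (C.gca r)[id]? = some ⟨s, none⟩) :
      Step C none
        { C.goto i (if c then .writeS cmd r t else .rereadS cmd r t fun _ => none) with
          gca := Function.update C.gca r ((C.gca r).set id ⟨s, some (t, c)⟩) }
  /-- `S[i] ← (r, s)` -/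
  | writeS (C : Config A n) (i : Fin n) (cmd : Command n O) (r : ℕ) (s : CTrace A n)
      (h : C.ctrl i = .writeS cmd r s) :
      Step C none
        { C.goto i (.rereadS cmd r s fun _ => none) with S := Function.update C.S i (r, s) }
  /-- read `S[j]` -/
  | rereadS (C : Config A n) (i j : Fin n) (cmd : Command n O) (r : ℕ) (s : CTrace A n)
      (view : Fin n → Option (ℕ × CTrace A n))
      (h : C.ctrl i = .rereadS cmd r s view) (hj : view j = none) :
      Step C none (C.goto i (.rereadS cmd r s (Function.update view j (some (C.S j)))))
  /-- `(_, u) ← max S`; `cmd ∉ ops u`, so start another iteration, `r ← r + 1` -/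
  | again (C : Config A n) (i : Fin n) (cmd : Command n O) (r : ℕ) (s : CTrace A n)
      (view : Fin n → Option (ℕ × CTrace A n)) (r' : ℕ) (t : CTrace A n)
      (h : C.ctrl i = .rereadS cmd r s view) (hmax : IsMax view r' t) (ht : cmd ∉ t.ops) :
      Step C none (C.goto i (.readM cmd (r + 1) s fun _ => none))
  /-- `(_, u) ← max S`; `cmd ∈ ops u`, so return the value of `cmd` in `u` -/
  | finish (C : Config A n) (i : Fin n) (cmd : Command n O) (r : ℕ) (s : CTrace A n)
      (view : Fin n → Option (ℕ × CTrace A n)) (r' : ℕ) (t : CTrace A n) (v : R)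
      (h : C.ctrl i = .rereadS cmd r s view) (hmax : IsMax view r' t) (ht : cmd ∈ t.ops)
      (hv : t.Ret cmd v) :
      Step C (some (.res i v)) (C.goto i .idle)

/-- An execution, with the configuration `conf k` at time `k` and the event `hist k` produced
between the times `k` and `k + 1`. At each time, one process takes a step or nothing happens; so
the finite executions are those in which nothing happens from some time on. The GCA objects
satisfy their specification at all times, that is, in every finite prefix. -/
structure Execution (A : SeqObject O Q R) (n : ℕ) where
  conf : ℕ → Config A n
  hist : History n O R
  init : conf 0 = Config.initial A n
  step : ∀ k, Step (conf k) (hist k) (conf (k + 1)) ∨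
    (hist k = none ∧ conf (k + 1) = conf k)
  gcaSpec : ∀ k r, GCASpec ((conf k).gca r)

/-- In round `r`, some call has committed the trace `t`. -/
def Config.Committed {A : SeqObject O Q R} {n : ℕ} (C : Config A n) (r : ℕ) (t : CTrace A n) :
    Prop :=
  ∃ p ∈ C.gca r, p.output = some (t, true)

/-- `t` is committed in the largest round that has a committed trace; it is the empty trace if
there is no such round. -/
def Config.LastCommitted {A : SeqObject O Q R} {n : ℕ} (C : Config A n) (t : CTrace A n) :
    Prop :=
  (∃ r, C.Committed r t ∧ ∀ r' t', C.Committed r' t' → r' ≤ r) ∨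
  ((∀ r' t', ¬ C.Committed r' t') ∧ t = Trace.empty)

end UC

/-! The heart of the proof is that committed traces grow with the round. A process enters round `r +
1` with an output of round `r`, either its own or a committed trace read from `S`; round 1 may also
be entered with the empty trace. If `t` is committed in round `r`, then by adoption all outputs of
round `r` extend `t`. Hence all inputs of round `r + 1` extend `t`, so does their greatest lower
bound, and by common prefix so do the outputs of round `r + 1`. By induction `t` lies below every
output from round `r` on (`Config.Ok.le_of_committed`). The greatest lower bound exists because a
common prefix with the most operations is the greatest one (`Trace.mk_le_of_maximal`).

No committed trace repeats a command: processes append only missing commands, and the union in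
validity takes maxima of multiplicities.

The chain of committed traces has representatives each of which extends the previous ones
(`Trace.exists_chain`); together they form a finite or infinite word. A completed operation took its
response from a committed trace. This response depends neither on the representative
(`SchedEquiv.response_eq`) nor on what follows in the word, so the word yields it too. All commands
of that trace were invoked before the operation returned, so an operation invoked later stands
behind it, which is the real-time order (`History.isLinearization_of_word`). For finite executions
the argument is applied to the execution stopped at time `k`, whose word represents the last
committed trace. -/

section Schedules

variable {O : Type u} {Q : Type v} {R : Type w} {A : SeqObject O Q R}

/-! ### Cancellation and commutation in equivalent schedules -/

open Classical in
theorem occAt_cons {a b : O} {s : List O} {i k : ℕ} (h : OccAt (a :: s) b i k) :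
    (k = 0 ∧ a = b ∧ i = 0) ∨
      ∃ i' k', k = k' + 1 ∧ i = [a].count b + i' ∧ OccAt s b i' k' := by
  rcases k with _ | k
  · left
    obtain ⟨h1, h2⟩ := h
    simp at h1 h2
    exact ⟨rfl, h1, h2.symm⟩
  · right
    have h' : OccAt ([a] ++ s) b i (k + 1) := h
    rcases occAt_append.mp h' with ⟨hk, -⟩ | ⟨i', k', hk, hi, h''⟩
    · simp at hk
    · refine ⟨i', k', ?_, hi, h''⟩
      simp at hk
      omega

open Classical in
theorem OccAt.cons {b : O} {s : List O} {i k : ℕ} (h : OccAt s b i k) (a : O) :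
    OccAt (a :: s) b ([a].count b + i) (k + 1) := by
  have : OccAt ([a] ++ s) b ([a].count b + i) (k + 1) :=
    occAt_append.mpr (Or.inr ⟨i, k, by simp [add_comm], rfl, h⟩)
  exact this

theorem SchedEquiv.perm {s t : List O} (h : SchedEquiv A s t) : s.Perm t :=
  Multiset.coe_eq_coe.mp h.1

theorem SchedEquiv.of_perm {s t : List O} (h : s.Perm t)
    (h' : ∀ a i b j, A.Conflict a b → OccPrec s a i b j → OccPrec t a i b j) :
    SchedEquiv A s t :=
  ⟨Multiset.coe_eq_coe.mpr h, h'⟩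

-- Removing the common first letter shifts all positions by one and lowers the occurrence numbers of
-- `a` by one on both sides, so the order of occurrences survives.
open Classical in
theorem SchedEquiv.of_cons {a : O} {s t : List O} (h : SchedEquiv A (a :: s) (a :: t)) :
    SchedEquiv A s t := by
  refine .of_perm ((List.perm_cons a).mp h.perm) ?_
  rintro p i q j hpq ⟨k, l, hkl, hk, hl⟩
  obtain ⟨k', l', hkl', hk', hl'⟩ :=
    h.2 p _ q _ hpq ⟨k + 1, l + 1, by omega, hk.cons a, hl.cons a⟩
  rcases occAt_cons hk' with ⟨rfl, rfl, h0⟩ | ⟨i', k'', rfl, hi, hk''⟩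
  · simp at h0
  · rcases occAt_cons hl' with ⟨rfl, rfl, h0⟩ | ⟨j', l'', rfl, hj, hl''⟩
    · omega
    · obtain rfl : i = i' := by omega
      obtain rfl : j = j' := by omega
      exact ⟨k'', l'', by omega, hk'', hl''⟩

theorem SchedEquiv.cons {s t : List O} (a : O) (h : SchedEquiv A s t) :
    SchedEquiv A (a :: s) (a :: t) :=
  (SchedEquiv.refl A [a]).append h

theorem SchedEquiv.of_append_left {s t : List O} (u : List O)
    (h : SchedEquiv A (u ++ s) (u ++ t)) : SchedEquiv A s t := by
  induction u with
  | nil => exact h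
  | cons a u ih => exact ih h.of_cons

theorem schedEquiv_pair {a b : O} (h : ¬ A.Conflict a b) : SchedEquiv A [a, b] [b, a] := by
  refine .of_perm (List.Perm.swap _ _ _) ?_
  rintro p i q j hpq ⟨k, l, hkl, hk, hl⟩
  have hk1 := hk.1
  have hl1 := hl.1
  rcases l with _ | _ | l
  · omega
  · obtain rfl : k = 0 := by omega
    simp at hk1 hl1
    subst hk1 hl1
    exact absurd hpq h
  · simp at hl1

theorem schedEquiv_cons_append {a : O} {s : List O} (h : ∀ b ∈ s, ¬ A.Conflict a b)
    (t : List O) : SchedEquiv A (a :: (s ++ t)) (s ++ a :: t) := by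
  induction s with
  | nil => exact .refl A _
  | cons b s ih =>
    have h1 : SchedEquiv A (a :: b :: (s ++ t)) (b :: a :: (s ++ t)) :=
      (schedEquiv_pair (h b (by simp))).append (.refl A (s ++ t))
    exact h1.trans ((ih fun c hc => h c (by simp [hc])).cons b)

open Classical in
/-- A schedule equivalent to `a :: s` is obtained by inserting `a` into a schedule equivalent to
`s`, behind operations that do not conflict with it. -/
theorem SchedEquiv.exists_of_cons {a : O} {s t : List O} (h : SchedEquiv A (a :: s) t) :
    ∃ t₁ t₂, t = t₁ ++ a :: t₂ ∧ a ∉ t₁ ∧ (∀ b ∈ t₁, ¬ A.Conflict a b) ∧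
      SchedEquiv A s (t₁ ++ t₂) := by
  have ha : a ∈ t := h.perm.subset (by simp)
  obtain ⟨t₁, t₂, rfl, hat⟩ := List.eq_append_cons_of_mem ha
  have hc : ∀ b ∈ t₁, ¬ A.Conflict a b := by
    intro b hb hab
    have hne : a ≠ b := fun e => hat (e ▸ hb)
    -- If such a `b` conflicted with `a`, then occurrence 0 of `a`, which heads `a :: s`, would
    -- precede occurrence 0 of `b` in `t` as well. The latter lies in `t₁`, so `a` would occur in
    -- `t₁`.
    obtain ⟨m, hm⟩ := exists_occAt (s := t₁) (a := b) (i := 0) (List.count_pos_iff.mpr hb)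
    have hmt : m < t₁.length := by
      by_contra hcon
      have := hm.1
      rw [List.getElem?_eq_none (by omega)] at this
      cases this
    have hbs : b ∈ s := by
      have : b ∈ a :: s := h.perm.symm.subset (by simp [hb])
      simpa [hne.symm] using this
    obtain ⟨m', hm'⟩ := exists_occAt (s := s) (a := b) (i := 0) (List.count_pos_iff.mpr hbs)
    have hm'' := hm'.cons a
    rw [List.count_cons_of_ne hne] at hm''
    obtain ⟨k, l, hkl, hk, hl⟩ := h.2 a 0 b 0 hab
      ⟨0, m' + 1, by omega, ⟨by simp, by simp⟩, by simpa using hm''⟩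
    have e := hl.unique (occAt_append.mpr (Or.inl ⟨hmt, hm⟩))
    rcases occAt_append.mp hk with ⟨hk1, hk2⟩ | ⟨i', k', hk1, -, -⟩
    · exact hat (List.mem_of_getElem? hk2.1)
    · omega
  exact ⟨t₁, t₂, rfl, hat, hc, (h.trans (schedEquiv_cons_append hc t₂).symm).of_cons⟩

/-! ### Responses are invariant under equivalence -/

namespace SeqObject

open Classical in
/-- The response to the first occurrence of `a` in the schedule `s` executed from `q`. -/
noncomputable def response (A : SeqObject O Q R) (a : O) : List O → Q → Option R
  | [], _ => none
  | b :: s, q => if b = a then some (A.step b q).1 else response A a s (A.step b q).2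

theorem response_cons_cons (a b c : O) (h : ¬ A.Conflict b c) (s : List O) (q : Q) :
    A.response a (b :: c :: s) q = A.response a (c :: b :: s) q := by
  have hq : A.CommuteIn q b c := by
    by_contra hn
    exact h ⟨q, hn⟩
  obtain ⟨rb, rc, q₁, q₂, q', h1, h2, h3, h4⟩ := hq
  by_cases hb : b = a <;> by_cases hc : c = a
  · subst hb hc; rfl
  all_goals simp [response, hb, hc, h1, h2, h3, h4]
  · subst hb; simp [h1, h4]
  · subst hc; simp [h3, h2]

theorem response_cons_append (a b : O) {s : List O} (h : ∀ c ∈ s, ¬ A.Conflict b c)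
    (t : List O) (q : Q) :
    A.response a (b :: (s ++ t)) q = A.response a (s ++ b :: t) q := by
  induction s generalizing q with
  | nil => rfl
  | cons c s ih =>
    rw [List.cons_append, response_cons_cons a b c (h c (by simp)), List.cons_append, response,
      ih fun d hd => h d (by simp [hd])]
    rfl

end SeqObject

/-- The first operation of `s` can be moved to the front of `t` past operations that do not conflict
with it. Each such swap leaves all responses and the resulting state unchanged. -/
theorem SchedEquiv.response_eq {s t : List O} (h : SchedEquiv A s t) (a : O) (q : Q) :
    A.response a s q = A.response a t q := by
  induction s generalizing t q with
  | nil => rw [List.nil_perm.mp h.perm]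
  | cons b s ih =>
    obtain ⟨t₁, t₂, rfl, -, hc, hs⟩ := h.exists_of_cons
    rw [← SeqObject.response_cons_append a b hc, SeqObject.response, ih hs]
    rfl

-- Links the recursive `response`, suited to induction, with `SchedRet`, which is the right-hand
-- side at `q = A.init`.
open Classical in
theorem SeqObject.response_eq_some_iff {s : List O} {a : O} {q : Q} {r : R} :
    A.response a s q = some r ↔ ∃ k q', OccAt s a 0 k ∧ (A.run s q)[k]? = some (r, q') := by
  induction s generalizing q with
  | nil => simp [SeqObject.response, OccAt]
  | cons b s ih =>
    by_cases hb : b = a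
    · subst hb
      simp only [SeqObject.response, if_true, Option.some.injEq]
      constructor
      · rintro rfl
        exact ⟨0, (A.step b q).2, ⟨by simp, by simp⟩, by simp [SeqObject.run]⟩
      · rintro ⟨k, q', hk, hr⟩
        rcases occAt_cons hk with ⟨rfl, -, -⟩ | ⟨i', k', -, h0, -⟩
        · simp [SeqObject.run] at hr
          rw [hr]
        · rw [List.count_cons_self] at h0
          omega
    · simp only [SeqObject.response, if_neg hb]
      rw [ih]
      constructor
      · rintro ⟨k, q', hk, hr⟩
        have := hk.cons b
        rw [List.count_cons_of_ne hb] at this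
        exact ⟨k + 1, q', by simpa using this, by simpa [SeqObject.run] using hr⟩
      · rintro ⟨k, q', hk, hr⟩
        rcases occAt_cons hk with ⟨-, h0, -⟩ | ⟨i', k', rfl, h0, hk'⟩
        · exact absurd h0 hb
        · obtain rfl : i' = 0 := by omega
          exact ⟨k', q', hk', by simpa [SeqObject.run] using hr⟩

theorem SchedRet.of_schedEquiv {s t : List O} {a : O} {r : R} (hr : SchedRet A s a r)
    (h : SchedEquiv A s t) : SchedRet A t a r :=
  SeqObject.response_eq_some_iff.mp
    ((h.response_eq a A.init).symm.trans (SeqObject.response_eq_some_iff.mpr hr))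

end Schedules

/-! ### The prefix order on traces -/

namespace Trace

variable {O : Type u} {Q : Type v} {R : Type w} {A : SeqObject O Q R}

theorem mk_eq_mk {s t : List O} : (mk s : Trace A) = mk t ↔ SchedEquiv A s t :=
  Quotient.eq (r := schedSetoid A)

theorem exists_mk (x : Trace A) : ∃ s, mk s = x := Quotient.exists_rep x

theorem mk_append (s t : List O) : (mk s : Trace A).append (mk t) = mk (s ++ t) := rfl

theorem ops_mk (s : List O) : (mk s : Trace A).ops = s := rfl

theorem ops_empty : (empty : Trace A).ops = 0 := rfl

theorem ops_append (x y : Trace A) : (x.append y).ops = x.ops + y.ops := by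
  obtain ⟨s, rfl⟩ := exists_mk x
  obtain ⟨t, rfl⟩ := exists_mk y
  simp [mk_append, ops_mk]

theorem append_assoc (x y z : Trace A) : (x.append y).append z = x.append (y.append z) := by
  obtain ⟨s, rfl⟩ := exists_mk x
  obtain ⟨t, rfl⟩ := exists_mk y
  obtain ⟨r, rfl⟩ := exists_mk z
  simp [mk_append]

theorem append_empty (x : Trace A) : x.append empty = x := by
  obtain ⟨s, rfl⟩ := exists_mk x
  simp [empty, mk_append]

theorem empty_append (x : Trace A) : empty.append x = x := by
  obtain ⟨s, rfl⟩ := exists_mk x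
  rfl

theorem le_append (x y : Trace A) : x ≤ x.append y := ⟨y, rfl⟩

theorem le_refl (x : Trace A) : x ≤ x := ⟨empty, (append_empty x).symm⟩

theorem empty_le (x : Trace A) : empty ≤ x := ⟨x, (empty_append x).symm⟩

theorem le_trans {x y z : Trace A} (h : x ≤ y) (h' : y ≤ z) : x ≤ z := by
  obtain ⟨a, rfl⟩ := h
  obtain ⟨b, rfl⟩ := h'
  exact ⟨a.append b, append_assoc _ _ _⟩

theorem ops_le {x y : Trace A} (h : x ≤ y) : x.ops ≤ y.ops := by
  obtain ⟨z, rfl⟩ := h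
  rw [ops_append]
  exact Multiset.le_add_right _ _

theorem eq_of_le_of_card {x y : Trace A} (h : x ≤ y) (hc : y.ops.card ≤ x.ops.card) :
    x = y := by
  obtain ⟨z, rfl⟩ := h
  obtain ⟨s, rfl⟩ := exists_mk z
  rw [ops_append, Multiset.card_add, ops_mk, Multiset.coe_card] at hc
  have : s = [] := List.length_eq_zero_iff.mp (by omega)
  subst this
  exact (append_empty x).symm

theorem le_antisymm {x y : Trace A} (h : x ≤ y) (h' : y ≤ x) : x = y :=
  eq_of_le_of_card h (Multiset.card_le_card (ops_le h'))

/-- The representative of the smaller trace can be prescribed; this turns chains of traces into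
chains of lists. -/
theorem exists_of_mk_le {s : List O} {x : Trace A} (h : mk s ≤ x) :
    ∃ t, x = mk (s ++ t) := by
  obtain ⟨z, rfl⟩ := h
  obtain ⟨t, rfl⟩ := exists_mk z
  exact ⟨t, rfl⟩

/-- Every lower bound lies below a lower bound with the largest number of operations. -/
theorem mk_le_of_maximal {S : Set (Trace A)} {g : Trace A} (hS : S.Nonempty)
    (hg : ∀ x ∈ S, g ≤ x)
    (hmax : ∀ g', (∀ x ∈ S, g' ≤ x) → g'.ops.card ≤ g.ops.card) (s : List O)
    (hs : ∀ x ∈ S, mk s ≤ x) : mk s ≤ g := by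
  induction s using List.reverseRecOn with
  | nil => exact empty_le g
  | append_singleton s a ih =>
    obtain ⟨w, rfl⟩ := exists_of_mk_le
      (ih fun x hx => le_trans (le_append (mk s) (mk [a])) (hs x hx))
    -- By induction `g = [s · w]`. Each `x ∈ S` equals both `[s · w · y]` and `[s · a · z]`;
    -- cancelling `s` compares `a · z` with `w · y`.
    have key : ∀ x ∈ S, ∃ y z, x = mk (s ++ w ++ y) ∧ SchedEquiv A (a :: z) (w ++ y) := by
      intro x hx
      obtain ⟨y, rfl⟩ := exists_of_mk_le (hg x hx)
      obtain ⟨z, hz⟩ := exists_of_mk_le (hs _ hx)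
      refine ⟨y, z, rfl, ?_⟩
      have := (mk_eq_mk.mp hz).symm
      simp only [List.append_assoc, List.cons_append, List.nil_append] at this
      exact this.of_append_left s
    -- If `a` occurs in `w`, nothing before its first occurrence conflicts with it, so it moves to
    -- the front of `w`. Otherwise the first `a` of each `y` moves to the place right behind `w`,
    -- and `[s · w · a]` is a lower bound with more operations than `g`.
    by_cases haw : a ∈ w
    · obtain ⟨x, hx⟩ := hS
      obtain ⟨y, z, -, h⟩ := key x hx
      obtain ⟨t₁, t₂, heq, hat, hc, -⟩ := h.exists_of_cons
      rcases List.append_eq_append_iff.mp heq with ⟨v, rfl, -⟩ | ⟨v, hw, hv⟩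
      · simp [haw] at hat
      · rcases v with _ | ⟨b, v⟩
        · simp at hw; exact absurd (hw ▸ haw) hat
        · obtain ⟨rfl, -⟩ := List.cons_eq_cons.mp hv
          subst hw
          refine ⟨mk (t₁ ++ v), ?_⟩
          rw [mk_append, mk_eq_mk, List.append_assoc]
          exact (SchedEquiv.refl A s).append (schedEquiv_cons_append hc v).symm
    · exfalso
      have := hmax (mk (s ++ w ++ [a])) fun x hx => by
        obtain ⟨y, z, rfl, h⟩ := key x hx
        obtain ⟨t₁, t₂, heq, hat, hc, -⟩ := h.exists_of_cons
        rcases List.append_eq_append_iff.mp heq with ⟨v, rfl, rfl⟩ | ⟨v, rfl, hv⟩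
        · refine ⟨mk (v ++ t₂), ?_⟩
          rw [mk_append, mk_eq_mk, List.append_assoc (s ++ w)]
          refine (SchedEquiv.refl A (s ++ w)).append (SchedEquiv.symm ?_)
          exact schedEquiv_cons_append (fun b hb => hc b (by simp [hb])) t₂
        · rcases v with _ | ⟨b, v⟩
          · refine ⟨mk t₂, ?_⟩
            simp at hv
            subst hv
            simp [mk_append]
          · obtain ⟨rfl, -⟩ := List.cons_eq_cons.mp hv
            simp at haw
      simp [ops_mk] at this

/-- A member of `S` bounds the number of operations of all lower bounds, so some lower bound attains
the maximum. -/
theorem exists_isGLB {S : Set (Trace A)} (hS : S.Nonempty) : ∃ g, IsGLB S g := by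
  let N : Set ℕ := {m | ∃ g : Trace A, (∀ x ∈ S, g ≤ x) ∧ g.ops.card = m}
  have hne : N.Nonempty := ⟨0, empty, fun x _ => empty_le x, rfl⟩
  have hbdd : BddAbove N := by
    obtain ⟨x, hx⟩ := hS
    refine ⟨x.ops.card, ?_⟩
    rintro m ⟨g, hg, rfl⟩
    exact Multiset.card_le_card (ops_le (hg x hx))
  obtain ⟨g, hg, hcard⟩ := Nat.sSup_mem hne hbdd
  refine ⟨g, fun x hx => hg x hx, fun h hh => ?_⟩
  obtain ⟨s, rfl⟩ := exists_mk h
  refine mk_le_of_maximal hS hg (fun g' hg' => ?_) s fun x hx => hh hx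
  rw [hcard]
  exact le_csSup hbdd ⟨g', hg', rfl⟩

end Trace

/-! ### Invocations and commands -/

namespace History

variable {n : ℕ} {O : Type u} {R : Type w} {H : History n O R}

/-- Of two invocations by one process, the later one has strictly more invocations before it, hence
a larger number. -/
theorem InvokesAt.time_unique {c : Command n O} {x y : ℕ} (hx : H.InvokesAt c x)
    (hy : H.InvokesAt c y) : x = y := by
  classical
  have key : ∀ {x y : ℕ}, H.InvokesAt c x → H.InvokesAt c y → ¬ x < y := by
    intro x y hx hy hlt
    have h := hx.2.symm.trans hy.2
    have : ((Finset.range x).filter fun z => ∃ o, H z = some (.inv c.proc o)).card <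
        ((Finset.range y).filter fun z => ∃ o, H z = some (.inv c.proc o)).card := by
      refine Finset.card_lt_card (Finset.ssubset_iff_of_subset ?_ |>.mpr ⟨x, ?_, ?_⟩)
      · intro z hz
        simp only [Finset.mem_filter, Finset.mem_range] at hz ⊢
        exact ⟨by omega, hz.2⟩
      · simp only [Finset.mem_filter, Finset.mem_range]
        exact ⟨hlt, _, hx.1⟩
      · simp
    omega
  have h1 := key hx hy
  have h2 := key hy hx
  omega

theorem InvokesAt.command_unique {c d : Command n O} {x : ℕ} (hc : H.InvokesAt c x)
    (hd : H.InvokesAt d x) : c = d := by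
  obtain ⟨h1, h2⟩ := hc
  obtain ⟨h3, h4⟩ := hd
  rw [h1] at h3
  obtain ⟨o, i, m⟩ := c
  obtain ⟨o', i', m'⟩ := d
  simp only [Option.some.injEq, Event.inv.injEq] at h3
  obtain ⟨rfl, rfl⟩ := h3
  simp only at h2 h4
  rw [h2, h4]

end History

namespace UC

variable {O : Type u} {Q : Type v} {R : Type w} {A : SeqObject O Q R} {n : ℕ}

/-- The command of the pending operation. -/
def Control.cmd : Control A n → Option (Command n O)
  | .idle => none
  | .announce c => some c
  | .readS c _ => some c
  | .readM c _ _ _ => some c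
  | .propose c _ _ => some c
  | .await c _ _ => some c
  | .writeS c _ _ => some c
  | .rereadS c _ _ _ => some c

theorem Step.seq_eq {C C' : Config A n} {e : Option (Event n O R)} (h : Step C e C')
    (i : Fin n) [Decidable (∃ o, e = some (.inv i o))] :
    C'.seq i = C.seq i + if ∃ o, e = some (.inv i o) then 1 else 0 := by
  cases h with
  | invoke j o h =>
    by_cases hij : i = j
    · subst hij; simp
    · simp [Function.update_of_ne hij, Ne.symm hij]
  | _ => simp [Config.goto]

/-- Serves to identify the invocation of a pending command as the last event of its process. -/
theorem Step.cmd_eq {C C' : Config A n} {e : Option (Event n O R)} (h : Step C e C')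
    {i : Fin n} {c : Command n O} (hc : (C'.ctrl i).cmd = some c) :
    (∃ o, e = some (.inv i o) ∧ c = ⟨o, i, C.seq i + 1⟩) ∨
      ((C.ctrl i).cmd = some c ∧ ∀ e', e = some e' → e'.proc ≠ i) := by
  cases h with
  | invoke j o h =>
    by_cases hij : i = j
    · subst hij
      simp only [Config.goto, Function.update_self, Control.cmd, Option.some.injEq] at hc
      exact Or.inl ⟨o, rfl, hc.symm⟩
    · simp only [Config.goto, Function.update_of_ne hij] at hc
      refine Or.inr ⟨hc, ?_⟩
      rintro _ ⟨⟩
      exact Ne.symm hij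
  | finish j cmd r s view r' t v h hmax ht hv =>
    by_cases hij : i = j
    · subst hij
      simp [Config.goto, Function.update_self, Control.cmd] at hc
    · simp only [Config.goto, Function.update_of_ne hij] at hc
      refine Or.inr ⟨hc, ?_⟩
      rintro _ ⟨⟩
      exact Ne.symm hij
  | respond j cmd r id s t b h hid =>
    refine Or.inr ⟨?_, by simp⟩
    by_cases hij : i = j
    · subst hij
      cases b <;> simpa [Config.goto, Control.cmd, h] using hc
    · simpa only [Config.goto, Function.update_of_ne hij] using hc
  | announce j | readS j | enter j | readM j | extend j | propose j | writeS j | rereadS j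
  | again j =>
    refine Or.inr ⟨?_, by simp⟩
    by_cases hij : i = j
    · subst hij
      simpa [Config.goto, Control.cmd, *] using hc
    · simpa only [Config.goto, Function.update_of_ne hij] using hc

namespace Execution

variable (α : Execution A n)

open Classical in
theorem seq_eq (k : ℕ) (i : Fin n) : (α.conf k).seq i =
    ((Finset.range k).filter fun y => ∃ o, α.hist y = some (.inv i o)).card := by
  induction k with
  | zero => simp [α.init, Config.initial]
  | succ k ih =>
    rw [Finset.range_add_one, Finset.filter_insert]
    rcases α.step k with h | ⟨h, h'⟩
    · rw [h.seq_eq i, ih]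
      split_ifs
      · rw [Finset.card_insert_of_notMem (by simp)]
      · rfl
    · rw [h', ih, if_neg (by simp [h])]

/-- The command of a pending operation is that of the last event of its process. -/
theorem exists_invokesAt {k : ℕ} {i : Fin n} {c : Command n O}
    (hc : ((α.conf k).ctrl i).cmd = some c) :
    ∃ x < k, α.hist.InvokesAt c x ∧ c.proc = i ∧
      ∀ l, x < l → l < k → ∀ e, α.hist l = some e → e.proc ≠ i := by
  induction k with
  | zero => simp [α.init, Config.initial, Control.cmd] at hc
  | succ k ih =>
    rcases α.step k with h | ⟨h, h'⟩
    · rcases h.cmd_eq hc with ⟨o, he, rfl⟩ | ⟨hc', he⟩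
      · refine ⟨k, by omega, ⟨he, ?_⟩, rfl, fun l h1 h2 => by omega⟩
        -- The counter before the step counts the earlier invocations, and invocations are numbered
        -- from 1.
        simp only [α.seq_eq k i]
      · obtain ⟨x, hx, h1, h2, h3⟩ := ih hc'
        refine ⟨x, by omega, h1, h2, fun l hl hl' => ?_⟩
        rcases Nat.lt_succ_iff_lt_or_eq.mp hl' with hl' | rfl
        · exact h3 l hl hl'
        · exact he
    · rw [h'] at hc
      obtain ⟨x, hx, h1, h2, h3⟩ := ih hc
      refine ⟨x, by omega, h1, h2, fun l hl hl' => ?_⟩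
      rcases Nat.lt_succ_iff_lt_or_eq.mp hl' with hl' | rfl
      · exact h3 l hl hl'
      · simp [h]

end Execution

/-! ### The invariant of the construction -/

/-- In round `r`, some call has returned `(t, c)`. -/
def Config.Out (C : Config A n) (r : ℕ) (t : CTrace A n) (c : Bool) : Prop :=
  ∃ p ∈ C.gca r, p.output = some (t, c)

/-- `(r, t)` may be the value of a register of `S`. -/
def Config.Stored (C : Config A n) (r : ℕ) (t : CTrace A n) : Prop :=
  (r = 0 ∧ t = Trace.empty) ∨ C.Committed r t

/-- A process may enter the round `r` with the trace `t`. -/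
def Config.Entry (C : Config A n) (r : ℕ) (t : CTrace A n) : Prop :=
  (r = 1 ∧ t = Trace.empty) ∨ ∃ r' c, r = r' + 1 ∧ C.Out r' t c

/-- No command occurs twice in `t`, and all of them satisfy `I`. -/
def Proper (I : Command n O → Prop) (t : CTrace A n) : Prop :=
  (∀ c ∈ t.ops, I c) ∧ t.ops.Nodup

/-- The local variables in a control state are consistent with the shared objects. -/
def Config.ControlOk (C : Config A n) (I : Command n O → Prop) : Control A n → Prop
  | .idle | .announce _ | .await _ _ _ => True
  | .readS _ view => ∀ j r s, view j = some (r, s) → C.Stored r s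
  | .readM _ r s view => C.Entry r s ∧ ∀ j c, view j = some (some c) → I c
  | .propose _ r s => ∃ s₀, C.Entry r s₀ ∧ s₀ ≤ s ∧ Proper I s
  | .writeS _ r s => C.Committed r s
  | .rereadS _ r s view => (∃ c, C.Out r s c) ∧ ∀ j r s, view j = some (r, s) → C.Stored r s

/-- The invariant, where `I` holds of the commands invoked so far. -/
structure Config.Ok (C : Config A n) (I : Command n O → Prop) : Prop where
  ctrl : ∀ i, C.ControlOk I (C.ctrl i)
  stored : ∀ j, C.Stored (C.S j).1 (C.S j).2
  announced : ∀ j c, C.M j = some c → I c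
  input : ∀ r, ∀ p ∈ C.gca r, ∃ s, C.Entry r s ∧ s ≤ p.input ∧ Proper I p.input

theorem Config.initial_ok (I : Command n O → Prop) : (Config.initial A n).Ok I where
  ctrl _ := trivial
  stored _ := Or.inl ⟨rfl, rfl⟩
  announced _ _ h := by simp [initial] at h
  input _ _ h := by simp [initial] at h

theorem Proper.mono {I I' : Command n O → Prop} (hI : ∀ c, I c → I' c) {t : CTrace A n}
    (h : Proper I t) : Proper I' t :=
  ⟨fun c hc => hI c (h.1 c hc), h.2⟩

theorem Config.Stored.mono {C C' : Config A n} (hC : ∀ r t c, C.Out r t c → C'.Out r t c)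
    {r : ℕ} {t : CTrace A n} (h : C.Stored r t) : C'.Stored r t :=
  h.imp id (hC r t true)

theorem Config.Entry.mono {C C' : Config A n} (hC : ∀ r t c, C.Out r t c → C'.Out r t c)
    {r : ℕ} {t : CTrace A n} (h : C.Entry r t) : C'.Entry r t :=
  h.imp id fun ⟨r', c, hr, h⟩ => ⟨r', c, hr, hC r' t c h⟩

theorem Config.ControlOk.mono {C C' : Config A n} {I I' : Command n O → Prop}
    (hC : ∀ r t c, C.Out r t c → C'.Out r t c) (hI : ∀ c, I c → I' c) {p : Control A n}
    (h : C.ControlOk I p) : C'.ControlOk I' p := by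
  cases p with
  | idle | announce | await => trivial
  | readS c view => exact fun j r s hj => (h j r s hj).mono hC
  | readM c r s view => exact ⟨h.1.mono hC, fun j c hj => hI c (h.2 j c hj)⟩
  | propose c r s =>
    obtain ⟨s₀, h1, h2, h3⟩ := h
    exact ⟨s₀, h1.mono hC, h2, h3.mono hI⟩
  | writeS c r s => exact hC r s true h
  | rereadS c r s view =>
    obtain ⟨⟨c, h1⟩, h2⟩ := h
    exact ⟨⟨c, hC r s c h1⟩, fun j r s hj => (h2 j r s hj).mono hC⟩

theorem Config.Stored.entry {C : Config A n} {r : ℕ} {t : CTrace A n} (h : C.Stored r t) :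
    C.Entry (r + 1) t := by
  rcases h with ⟨rfl, rfl⟩ | h
  · exact Or.inl ⟨rfl, rfl⟩
  · exact Or.inr ⟨r, true, rfl, h⟩

-- The union takes maxima of multiplicities, so it creates no repetitions. Validity thereby passes
-- properness from inputs to outputs.
open Classical in
theorem proper_foldr_union {T : Type*} {I : O → Prop} (P : List T) (f : T → Multiset O)
    (h : ∀ p ∈ P, (∀ c ∈ f p, I c) ∧ (f p).Nodup) :
    (∀ c ∈ (P.map f).foldr (fun X Y => X ∪ Y) 0, I c) ∧
      ((P.map f).foldr (fun X Y => X ∪ Y) 0).Nodup := by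
  induction P with
  | nil => simp
  | cons p P ih =>
    obtain ⟨h1, h2⟩ := ih fun q hq => h q (by simp [hq])
    obtain ⟨h3, h4⟩ := h p (by simp)
    simp only [List.map_cons, List.foldr_cons, Multiset.mem_union, Multiset.nodup_union]
    exact ⟨fun c hc => hc.elim (h3 c) (h1 c), h4, h2⟩

theorem Config.Ok.proper_of_out {C : Config A n} {I : Command n O → Prop} (h : C.Ok I)
    (hC : ∀ r, GCASpec (C.gca r)) {r : ℕ} {t : CTrace A n} {c : Bool} (ht : C.Out r t c) :
    Proper I t := by
  classical
  obtain ⟨p, hp, ho⟩ := ht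
  have hle := (hC r).validity p hp t c ho
  have := proper_foldr_union (I := I) (C.gca r) (fun q => q.input.ops)
    fun q hq => (h.input r q hq).choose_spec.2.2
  exact ⟨fun d hd => this.1 d (Multiset.subset_of_le hle hd), Multiset.nodup_of_le hle this.2⟩

theorem Config.Ok.proper_of_entry {C : Config A n} {I : Command n O → Prop} (h : C.Ok I)
    (hC : ∀ r, GCASpec (C.gca r)) {r : ℕ} {t : CTrace A n} (ht : C.Entry r t) :
    Proper I t := by
  rcases ht with ⟨-, rfl⟩ | ⟨r', c, -, ht⟩
  · simp [Proper, Trace.ops_empty]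
  · exact h.proper_of_out hC ht

theorem IsMissing.proper {I : Command n O → Prop}
    {view : Fin n → Option (Option (Command n O))} {s : CTrace A n} {l : List (Command n O)}
    (hl : IsMissing view s l) (hs : Proper I s) (hv : ∀ j c, view j = some (some c) → I c) :
    Proper I (s.append (Trace.mk l)) := by
  obtain ⟨-, hnd, hmem⟩ := hl
  rw [Proper, Trace.ops_append, Trace.ops_mk, Multiset.nodup_add]
  refine ⟨fun c hc => ?_, hs.2, hnd, ?_⟩
  · rcases Multiset.mem_add.mp hc with hc | hc
    · exact hs.1 c hc
    · obtain ⟨⟨j, hj⟩, -⟩ := (hmem c).mp hc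
      exact hv j c hj
  · rw [Multiset.disjoint_right]
    exact fun {c} hc => ((hmem c).mp hc).2

theorem Step.out_mono {C C' : Config A n} {e : Option (Event n O R)} (h : Step C e C')
    (r : ℕ) (t : CTrace A n) (c : Bool) (ho : C.Out r t c) : C'.Out r t c := by
  obtain ⟨p, hp, ho⟩ := ho
  cases h with
  | propose i cmd r' s h =>
    refine ⟨p, ?_, ho⟩
    by_cases hr : r = r'
    · subst hr; simp [hp]
    · simpa [Function.update_of_ne hr] using hp
  | respond i cmd r' id s t' c' h hid =>
    refine ⟨p, ?_, ho⟩
    by_cases hr : r = r'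
    · subst hr
      obtain ⟨m, hm⟩ := List.mem_iff_getElem?.mp hp
      -- The call that returns now had no output before, so it is not the one that witnesses `ho`.
      have hne : id ≠ m := by
        rintro rfl
        rw [hid, Option.some.injEq] at hm
        subst hm
        simp at ho
      simp only [Function.update_self]
      exact List.mem_iff_getElem?.mpr ⟨m, by rw [List.getElem?_set_ne hne, hm]⟩
    · simpa [Function.update_of_ne hr] using hp
  | _ => exact ⟨p, hp, ho⟩

/-- All clauses are monotone in the outputs and in the set of invoked commands, so only what the
step changes has to be checked. `hcmd` is needed when a pending command is written to `M`. -/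
theorem Step.ok {C C' : Config A n} {e : Option (Event n O R)} (h : Step C e C')
    {I I' : Command n O → Prop} (hok : C.Ok I) (hC : ∀ r, GCASpec (C.gca r))
    (hI : ∀ c, I c → I' c) (hcmd : ∀ i c, (C.ctrl i).cmd = some c → I' c) : C'.Ok I' := by
  have hout := h.out_mono
  have hctrl : ∀ {i : Fin n} {p : Control A n}, C'.ctrl = Function.update C.ctrl i p →
      C'.ControlOk I' p → ∀ j, C'.ControlOk I' (C'.ctrl j) := by
    intro i p he hp j
    rw [he]
    by_cases hj : j = i
    · subst hj; simpa using hp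
    · rw [Function.update_of_ne hj]
      exact (hok.ctrl j).mono hout hI
  have hstored : ∀ j, C'.Stored (C.S j).1 (C.S j).2 := fun j => (hok.stored j).mono hout
  have hann : ∀ j c, C.M j = some c → I' c := fun j c hj => hI c (hok.announced j c hj)
  have hinput : ∀ r, ∀ p ∈ C.gca r, ∃ s, C'.Entry r s ∧ s ≤ p.input ∧ Proper I' p.input := by
    intro r p hp
    obtain ⟨s, h1, h2, h3⟩ := hok.input r p hp
    exact ⟨s, h1.mono hout, h2, h3.mono hI⟩
  cases h with
  | invoke i o h => exact ⟨hctrl rfl trivial, hstored, hann, hinput⟩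
  | announce i cmd h =>
    refine ⟨hctrl rfl fun j r s hj => by simp at hj, hstored, fun j c hj => ?_, hinput⟩
    by_cases hij : j = i
    · subst hij
      simp only [Function.update_self] at hj
      exact hcmd j c (by rw [h]; exact hj)
    · simp only [Function.update_of_ne hij] at hj
      exact hann j c hj
  | readS i j cmd view h hj =>
    have hc := (hok.ctrl i).mono hout hI
    rw [h] at hc
    refine ⟨hctrl rfl fun j' r s hj' => ?_, hstored, hann, hinput⟩
    by_cases hjj : j' = j
    · subst hjj
      simp only [Function.update_self, Option.some.injEq] at hj'
      have := hstored j'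
      rwa [hj'] at this
    · rw [Function.update_of_ne hjj] at hj'
      exact hc j' r s hj'
  | enter i cmd view r s h hmax =>
    have hc := (hok.ctrl i).mono hout hI
    rw [h] at hc
    obtain ⟨j, hj⟩ := hmax.2.1
    exact ⟨hctrl rfl ⟨(hc j r s hj).entry, fun j c hj => by simp at hj⟩, hstored, hann, hinput⟩
  | readM i j cmd r s view h hj =>
    have hc := (hok.ctrl i).mono hout hI
    rw [h] at hc
    refine ⟨hctrl rfl ⟨hc.1, fun j' c hj' => ?_⟩, hstored, hann, hinput⟩
    by_cases hjj : j' = j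
    · subst hjj
      simp only [Function.update_self, Option.some.injEq] at hj'
      exact hann j' c hj'
    · rw [Function.update_of_ne hjj] at hj'
      exact hc.2 j' c hj'
  | extend i cmd r s view l h hl =>
    have hc := hok.ctrl i
    rw [h] at hc
    exact ⟨hctrl rfl ⟨s, hc.1.mono hout, Trace.le_append _ _,
      (hl.proper (hok.proper_of_entry hC hc.1) hc.2).mono hI⟩, hstored, hann, hinput⟩
  | propose i cmd r s h =>
    have hc := (hok.ctrl i).mono hout hI
    rw [h] at hc
    refine ⟨hctrl rfl trivial, hstored, hann, fun r' p hp => ?_⟩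
    by_cases hr : r' = r
    · subst hr
      simp only [Function.update_self, List.mem_append, List.mem_singleton] at hp
      rcases hp with hp | rfl
      · exact hinput r' p hp
      · exact hc
    · simp only [Function.update_of_ne hr] at hp
      exact hinput r' p hp
  | respond i cmd r id s t c h hid =>
    refine ⟨hctrl rfl ?_, hstored, hann, fun r' p hp => ?_⟩
    · have hlt : id < (C.gca r).length := (List.getElem?_eq_some_iff.mp hid).1
      have ho : Config.Out { C.goto i (if c then .writeS cmd r t else .rereadS cmd r t
          fun _ => none) with
          gca := Function.update C.gca r ((C.gca r).set id ⟨s, some (t, c)⟩) } r t c := by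
        refine ⟨⟨s, some (t, c)⟩, ?_, rfl⟩
        simp only [Function.update_self]
        exact List.mem_set hlt _
      cases c with
      | true => exact ho
      | false => exact ⟨⟨_, ho⟩, fun j r s hj => by simp at hj⟩
    · by_cases hr : r' = r
      · subst hr
        simp only [Function.update_self] at hp
        rcases List.mem_or_eq_of_mem_set hp with hp | rfl
        · exact hinput r' p hp
        -- The response changes only the output of the call; its input is that of the old entry.
        · have := hinput r' _ (List.mem_of_getElem? hid)
          exact this
      · simp only [Function.update_of_ne hr] at hp
        exact hinput r' p hp
  | writeS i cmd r s h =>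
    have hc := (hok.ctrl i).mono hout hI
    rw [h] at hc
    refine ⟨hctrl rfl ⟨⟨true, hc⟩, fun j r s hj => by simp at hj⟩, fun j => ?_, hann, hinput⟩
    by_cases hij : j = i
    · subst hij
      simp only [Function.update_self]
      exact Or.inr hc
    · simp only [Function.update_of_ne hij]
      exact hstored j
  | rereadS i j cmd r s view h hj =>
    have hc := (hok.ctrl i).mono hout hI
    rw [h] at hc
    refine ⟨hctrl rfl ⟨hc.1, fun j' r s hj' => ?_⟩, hstored, hann, hinput⟩
    by_cases hjj : j' = j
    · subst hjj
      simp only [Function.update_self, Option.some.injEq] at hj'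
      have := hstored j'
      rwa [hj'] at this
    · rw [Function.update_of_ne hjj] at hj'
      exact hc.2 j' r s hj'
  | again i cmd r s view r' t h hmax ht =>
    have hc := (hok.ctrl i).mono hout hI
    rw [h] at hc
    obtain ⟨⟨c, hc⟩, -⟩ := hc
    -- The next round is entered with the process's own output `s` of round `r`, not with the trace
    -- `t` just read.
    exact ⟨hctrl rfl ⟨Or.inr ⟨r, c, rfl, hc⟩, fun j c hj => by simp at hj⟩, hstored, hann, hinput⟩
  | finish i cmd r s view r' t v h hmax ht hv =>
    exact ⟨hctrl rfl trivial, hstored, hann, hinput⟩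

/-! ### Growth of committed traces and origin of responses -/

theorem Config.Ok.not_out_zero {C : Config A n} {I : Command n O → Prop} (h : C.Ok I)
    {t : CTrace A n} {c : Bool} : ¬ C.Out 0 t c := by
  rintro ⟨p, hp, -⟩
  obtain ⟨s, ⟨h0, -⟩ | ⟨r', c, h0, -⟩, -⟩ := h.input 0 p hp
  · omega
  · omega

/-- Committed traces are extended by all outputs of later rounds. -/
theorem Config.Ok.le_of_committed {C : Config A n} {I : Command n O → Prop} (h : C.Ok I)
    (hC : ∀ r, GCASpec (C.gca r)) {r r' : ℕ} {t t' : CTrace A n} {c : Bool}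
    (ht : C.Committed r t) (hr : r ≤ r') (ht' : C.Out r' t' c) : t ≤ t' := by
  induction r', hr using Nat.le_induction generalizing t' c with
  | base =>
    obtain ⟨p, hp, hpt⟩ := ht
    obtain ⟨q, hq, hqt⟩ := ht'
    exact (hC r).adoption p hp t hpt q hq t' c hqt
  | succ r' hr ih =>
    obtain ⟨p, hp, hpt⟩ := ht'
    obtain ⟨g, hg⟩ := Trace.exists_isGLB
      (S := {s | ∃ p ∈ C.gca (r' + 1), p.input = s}) ⟨p.input, p, hp, rfl⟩
    -- It suffices that `t` is below every input of round `r' + 1`, for then it is below their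
    -- greatest lower bound.
    refine Trace.le_trans (hg.2 ?_) ((hC (r' + 1)).commonPrefix g hg p hp t' c hpt)
    rintro _ ⟨q, hq, rfl⟩
    obtain ⟨s, hs, hsq, -⟩ := h.input _ q hq
    refine Trace.le_trans ?_ hsq
    rcases hs with ⟨h1, -⟩ | ⟨r'', c', h1, hs⟩
    · obtain rfl : r = 0 := by omega
      exact absurd ht h.not_out_zero
    · obtain rfl : r' = r'' := by omega
      exact ih hs

namespace Execution

variable (α : Execution A n)

/-- The commands invoked before time `k`. -/
def Invoked (k : ℕ) (c : Command n O) : Prop := ∃ x < k, α.hist.InvokesAt c x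

theorem ok (k : ℕ) : (α.conf k).Ok (α.Invoked k) := by
  induction k with
  | zero => rw [α.init]; exact Config.initial_ok _
  | succ k ih =>
    have hI : ∀ c, α.Invoked k c → α.Invoked (k + 1) c :=
      fun c ⟨x, hx, h⟩ => ⟨x, by omega, h⟩
    rcases α.step k with h | ⟨-, h⟩
    · refine h.ok ih (α.gcaSpec k) hI fun i c hc => ?_
      obtain ⟨x, hx, h, -⟩ := α.exists_invokesAt hc
      exact ⟨x, by omega, h⟩
    · rw [h]
      exact ⟨fun i => (ih.ctrl i).mono (fun _ _ _ h => h) hI, ih.stored,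
        fun j c hj => hI c (ih.announced j c hj), fun r p hp => by
          obtain ⟨s, h1, h2, h3⟩ := ih.input r p hp
          exact ⟨s, h1, h2, h3.mono hI⟩⟩

theorem committed_mono {k k' : ℕ} (hk : k ≤ k') {r : ℕ} {t : CTrace A n}
    (h : (α.conf k).Committed r t) : (α.conf k').Committed r t := by
  induction k', hk using Nat.le_induction with
  | base => exact h
  | succ k' _ ih =>
    rcases α.step k' with hs | ⟨-, hs⟩
    · exact hs.out_mono r t true ih
    · rw [hs]; exact ih

/-- At some time, `t` is committed in round `r`. -/
def Commits (r : ℕ) (t : CTrace A n) : Prop := ∃ k, (α.conf k).Committed r t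

theorem not_commits_zero (t : CTrace A n) : ¬ α.Commits 0 t :=
  fun ⟨k, h⟩ => (α.ok k).not_out_zero h

theorem commits_le {r r' : ℕ} {t t' : CTrace A n} (h : α.Commits r t) (h' : α.Commits r' t')
    (hr : r ≤ r') : t ≤ t' := by
  obtain ⟨k, h⟩ := h
  obtain ⟨k', h'⟩ := h'
  exact (α.ok (max k k')).le_of_committed (α.gcaSpec _)
    (α.committed_mono (le_max_left _ _) h) hr (α.committed_mono (le_max_right _ _) h')

/-- A completed operation takes its response from a committed trace, all commands of which have
been invoked before. -/
theorem exists_commits_of_completesAt {x k : ℕ} {v : R} (h : α.hist.CompletesAt x k v) :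
    ∃ c r t, α.hist.InvokesAt c x ∧ α.Commits r t ∧ c ∈ t.ops ∧ t.Ret c v ∧
      ∀ d ∈ t.ops, α.Invoked k d := by
  obtain ⟨i, o, hx, hxk, hk, hbetween⟩ := h
  have hstep := (α.step k).resolve_right (by simp [hk])
  rw [hk] at hstep
  generalize hC' : α.conf (k + 1) = C' at hstep
  generalize he : some (Event.res i v) = e at hstep
  have hok := α.ok k
  cases hstep with
  | finish i' cmd r s view r' t v' h hmax ht hv =>
    simp only [Option.some.injEq, Event.res.injEq] at he
    obtain ⟨rfl, rfl⟩ := he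
    have hc := hok.ctrl i
    rw [h] at hc
    obtain ⟨j, hj⟩ := hmax.2.1
    rcases hc.2 j r' t hj with ⟨-, rfl⟩ | hcom
    · simp [Trace.ops_empty] at ht
    obtain ⟨y, hy, hinv, hproc, hb⟩ := α.exists_invokesAt (k := k) (i := i) (c := cmd)
      (by rw [h]; rfl)
    -- Both `x` and `y` are the time of the last event of process `i` before `k`.
    have hxy : x = y := by
      rcases lt_trichotomy x y with hlt | heq | hgt
      · exact absurd hproc (hbetween y hlt hy _ hinv.1)
      · exact heq
      · exact absurd rfl (hb x hgt hxk _ hx)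
    subst hxy
    exact ⟨cmd, r', t, hinv, ⟨k, hcom⟩, ht, hv,
      (hok.proper_of_out (α.gcaSpec k) hcom).1⟩
  | _ => simp at he

/-- Only finitely many rounds are in use at any time, so a largest committed round exists as soon as
there is one. -/
theorem exists_gca_eq_nil (k : ℕ) : ∃ B, ∀ r, B < r → (α.conf k).gca r = [] := by
  induction k with
  | zero => exact ⟨0, fun r _ => by simp [α.init, Config.initial]⟩
  | succ k ih =>
    obtain ⟨B, hB⟩ := ih
    rcases α.step k with h | ⟨-, h⟩
    · generalize α.conf (k + 1) = C' at h
      generalize α.hist k = e at h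
      cases h with
      | propose i cmd r s h =>
        exact ⟨max B r, fun r' hr' => by
          simp only [Function.update_of_ne (show r' ≠ r by omega)]
          exact hB r' (by omega)⟩
      | respond i cmd r id s t c h hid =>
        exact ⟨max B r, fun r' hr' => by
          simp only [Function.update_of_ne (show r' ≠ r by omega)]
          exact hB r' (by omega)⟩
      | _ => exact ⟨B, hB⟩
    · exact ⟨B, by rwa [h]⟩

end Execution

end UC

/-! ### Words of commands and linearizations -/

section Words

variable {O : Type u} {Q : Type v} {R : Type w}

/-- The states visited when the finite or infinite word `W` is executed. -/
def SeqObject.states (A : SeqObject O Q R) (W : ℕ → Option O) : ℕ → Q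
  | 0 => A.init
  | m + 1 => match W m with
    -- Behind the end of a finite word the state is merely repeated.
    | none => A.states W m
    | some o => (A.step o (A.states W m)).2

theorem SeqObject.states_succ (A : SeqObject O Q R) {W : ℕ → Option O} {m : ℕ} {o : O}
    (h : W m = some o) : A.states W (m + 1) = (A.step o (A.states W m)).2 := by
  simp only [SeqObject.states, h]

/-- The state sequence `q` is arbitrary so that the induction can shift it by one. -/
theorem SeqObject.run_getElem? (A : SeqObject O Q R) {s : List O} {q : ℕ → Q}
    (hq : ∀ m o, s[m]? = some o → q (m + 1) = (A.step o (q m)).2) (k : ℕ) :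
    (A.run s (q 0))[k]? = s[k]?.map fun o => A.step o (q k) := by
  induction s generalizing q k with
  | nil => simp [SeqObject.run]
  | cons a s ih =>
    rcases k with _ | k
    · simp [SeqObject.run]
    · simp only [SeqObject.run, List.getElem?_cons_succ]
      rw [← hq 0 a (by simp)]
      exact ih (q := fun m => q (m + 1)) (fun m o h => hq (m + 1) o (by simpa using h)) k

/-- The list `p` is a prefix of the finite or infinite word `W`. -/
def IsWordPrefix (p : List O) (W : ℕ → Option O) : Prop := ∀ m < p.length, W m = p[m]?

theorem IsWordPrefix.run_getElem? {A : SeqObject O Q R} {p : List O} {W : ℕ → Option O}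
    (h : IsWordPrefix p W) (k : ℕ) :
    (A.run p A.init)[k]? = p[k]?.map fun o => A.step o (A.states W k) :=
  A.run_getElem? (q := A.states W) (fun m o hm => A.states_succ (by
    rw [h m (List.getElem?_eq_some_iff.mp hm).1, hm])) k

theorem List.Nodup.schedRet {A : SeqObject O Q R} {s : List O} (hs : s.Nodup) {m : ℕ} {a : O}
    (ha : s[m]? = some a) :
    SchedRet A s a (A.step a (A.states (fun m => s[m]?) m)).1 := by
  classical
  refine ⟨m, (A.step a (A.states (fun m => s[m]?) m)).2, ⟨ha, ?_⟩, ?_⟩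
  · obtain ⟨hm, rfl⟩ := List.getElem?_eq_some_iff.mp ha
    rw [List.count_eq_zero]
    intro hmem
    obtain ⟨j, hj, he⟩ := List.mem_take_iff_getElem.mp hmem
    have := (List.Nodup.getElem_inj_iff hs).mp he
    omega
  · rw [IsWordPrefix.run_getElem? (W := fun m => s[m]?) fun m _ => rfl, ha]
    rfl

theorem History.exists_time {n : ℕ} (H : History n O R) :
    ∃ τ : Command n O → ℕ, ∀ c x, H.InvokesAt c x → H.InvokesAt c (τ c) := by
  classical
  refine ⟨fun c => if h : ∃ x, H.InvokesAt c x then h.choose else 0, fun c x h => ?_⟩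
  have hx : ∃ x, H.InvokesAt c x := ⟨x, h⟩
  simp only [dif_pos hx]
  exact hx.choose_spec

/-- A word of commands without repetition is a linearization if every completed operation takes
its response from a prefix of the word whose commands are invoked before its completion. -/
theorem History.isLinearization_of_word {n : ℕ} {A : SeqObject O Q R} {H : History n O R}
    {W : ℕ → Option (Command n O)} {τ : Command n O → ℕ} {L : Stream'.Seq (ℕ × R)}
    (hL : ∀ m, L.get? m = (W m).map fun c =>
      (τ c, (A.step c.op ((A.onCommands n).states W m)).1))
    (hτ : ∀ m c, W m = some c → H.InvokesAt c (τ c))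
    (hinj : ∀ m m' c, W m = some c → W m' = some c → m = m')
    (hcomp : ∀ x k r, H.CompletesAt x k r → ∃ p c, IsWordPrefix p W ∧ H.InvokesAt c x ∧
      SchedRet (A.onCommands n) p c r ∧ ∀ d ∈ p, ∃ y < k, H.InvokesAt d y) :
    H.IsLinearization A L := by
  have get : ∀ {m x r}, L.get? m = some (x, r) → ∃ c, W m = some c ∧ H.InvokesAt c x ∧
      (A.step c.op ((A.onCommands n).states W m)).1 = r := by
    intro m x r h
    rw [hL, Option.map_eq_some_iff] at h
    obtain ⟨c, hc, he⟩ := h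
    rw [Prod.mk.injEq] at he
    exact ⟨c, hc, he.1 ▸ hτ m c hc, he.2⟩
  refine ⟨?_, ?_, ?_, ?_, ?_⟩
  · intro m x r h
    obtain ⟨c, -, hx, -⟩ := get h
    exact ⟨_, _, hx.1⟩
  · intro m m' x r r' h h'
    obtain ⟨c, hc, hx, -⟩ := get h
    obtain ⟨c', hc', hx', -⟩ := get h'
    obtain rfl := hx.command_unique hx'
    exact hinj m m' c hc hc'
  · intro x k r h
    obtain ⟨p, c, hp, hx, ⟨m, q, hocc, hrun⟩, -⟩ := hcomp x k r h
    have hm : m < p.length := (List.getElem?_eq_some_iff.mp hocc.1).1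
    have hW : W m = some c := by rw [hp m hm, hocc.1]
    refine ⟨m, ?_⟩
    rw [hp.run_getElem?, hocc.1, Option.map_some, Option.some.injEq] at hrun
    rw [hL, hW, Option.map_some, (hτ m c hW).time_unique hx,
      show A.step c.op ((A.onCommands n).states W m) = (r, q) from hrun]
  · intro m m' x y r r' k r'' h h' hk hky
    obtain ⟨c, hc, hx, -⟩ := get h
    obtain ⟨d, hd, hy, -⟩ := get h'
    obtain ⟨p, c', hp, hx', ⟨m₁, q, hocc, -⟩, hinv⟩ := hcomp x k r'' hk
    obtain rfl := hx.command_unique hx'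
    have hm₁ : m₁ < p.length := (List.getElem?_eq_some_iff.mp hocc.1).1
    obtain rfl := hinj m m₁ c hc (by rw [hp m₁ hm₁, hocc.1])
    -- If `d` did not stand behind `c`, it would lie in the prefix `p`, hence be invoked before time
    -- `k`, whereas `k < y`.
    by_contra hlt
    have hm' : m' < p.length := by omega
    rw [hp m' hm'] at hd
    obtain ⟨z, hz, hdz⟩ := hinv d (List.mem_of_getElem? hd)
    have := hy.time_unique hdz
    omega
  · refine ⟨(A.onCommands n).states W, rfl, fun m x r i o h hx => ?_⟩
    obtain ⟨c, hc, hcx, hr⟩ := get h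
    have := hx.symm.trans hcx.1
    simp only [Option.some.injEq, Event.inv.injEq] at this
    rw [(A.onCommands n).states_succ hc, this.2, ← hr]
    rfl

end Words

/-- Traces that grow with their index have representatives such that each extends the previous
ones. -/
theorem Trace.exists_chain {O : Type u} {Q : Type v} {R : Type w} {A : SeqObject O Q R}
    {K : ℕ → Trace A → Prop} (h0 : ∀ t, ¬ K 0 t)
    (hK : ∀ r r' t t', K r t → K r' t' → r ≤ r' → t ≤ t') :
    ∃ l : ℕ → List O, (∀ r r', r ≤ r' → l r <+: l r') ∧
      (∀ r t, K r t → mk (l r) = t) ∧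
      ∀ b, (∃ r ≤ b, K r (mk (l b)) ∧ ∀ r' ≤ b, ∀ t, K r' t → r' ≤ r) ∨
        ((∀ r ≤ b, ∀ t, ¬ K r t) ∧ l b = []) := by
  classical
  -- The list grows only in rounds with a commit; in the others it is kept, so `l b` represents the
  -- trace of the last such round up to `b`.
  let l : ℕ → List O := fun r => Nat.rec [] (fun r s =>
    if h : ∃ z, K (r + 1) (mk (s ++ z)) then s ++ h.choose else s) r
  have hl : ∀ r, l (r + 1) =
      if h : ∃ z, K (r + 1) (mk (l r ++ z)) then l r ++ h.choose else l r := fun r => rfl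
  have hlast : ∀ b, (∃ r ≤ b, K r (mk (l b)) ∧ ∀ r' ≤ b, ∀ t, K r' t → r' ≤ r) ∨
      ((∀ r ≤ b, ∀ t, ¬ K r t) ∧ l b = []) := by
    intro b
    induction b with
    | zero =>
      refine Or.inr ⟨fun r hr t ht => ?_, rfl⟩
      obtain rfl : r = 0 := by omega
      exact h0 t ht
    | succ b ih =>
      by_cases hb : ∃ t, K (b + 1) t
      · obtain ⟨t, ht⟩ := hb
        have hle : mk (l b) ≤ t := by
          rcases ih with ⟨r, hr, hr', -⟩ | ⟨-, hnil⟩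
          · exact hK r (b + 1) _ t hr' ht (by omega)
          · rw [hnil]; exact empty_le t
        obtain ⟨z, rfl⟩ := exists_of_mk_le hle
        have hex : ∃ z, K (b + 1) (mk (l b ++ z)) := ⟨z, ht⟩
        left
        refine ⟨b + 1, _root_.le_refl _, ?_, fun r' hr' _ _ => hr'⟩
        rw [hl, dif_pos hex]
        exact hex.choose_spec
      · have hneg : ¬ ∃ z, K (b + 1) (mk (l b ++ z)) := fun ⟨z, hz⟩ => hb ⟨_, hz⟩
        rw [hl, dif_neg hneg]
        have hcases : ∀ {r t}, r ≤ b + 1 → K r t → r ≤ b := by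
          intro r t hr ht
          by_contra hc
          obtain rfl : r = b + 1 := by omega
          exact hb ⟨t, ht⟩
        rcases ih with ⟨r, hr, hr', hmax⟩ | ⟨hno, hnil⟩
        · exact Or.inl ⟨r, by omega, hr', fun r' h' t ht => hmax r' (hcases h' ht) t ht⟩
        · exact Or.inr ⟨fun r hr t ht => hno r (hcases hr ht) t ht, hnil⟩
  refine ⟨l, fun r r' hr => ?_, fun r t ht => ?_, hlast⟩
  · induction r', hr using Nat.le_induction with
    | base => exact List.prefix_rfl
    | succ r' _ ih =>
      refine ih.trans ?_
      rw [hl]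
      split_ifs
      · exact List.prefix_append _ _
      · exact List.prefix_rfl
  · rcases hlast r with ⟨r', hr', hK', hmax⟩ | ⟨hno, -⟩
    -- Traces of the same index bound each other, so they are equal.
    · obtain rfl : r = r' := _root_.le_antisymm (hmax r (_root_.le_refl r) t ht) hr'
      exact le_antisymm (hK r r _ _ hK' ht (_root_.le_refl r))
        (hK r r _ _ ht hK' (_root_.le_refl r))
    · exact absurd ht (hno r (_root_.le_refl r) t)

/-! ### Linearizations of infinite and of finite executions -/

namespace UC.Execution

variable {O : Type u} {Q : Type v} {R : Type w} {A : SeqObject O Q R} {n : ℕ}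
  (α : Execution A n)

theorem proper_of_commits {r : ℕ} {s : List (Command n O)} (h : α.Commits r (Trace.mk s)) :
    (∀ c ∈ s, ∃ x, α.hist.InvokesAt c x) ∧ s.Nodup := by
  obtain ⟨k, h⟩ := h
  obtain ⟨h1, h2⟩ := (α.ok k).proper_of_out (α.gcaSpec k) h
  exact ⟨fun c hc => (h1 c hc).imp fun x hx => hx.2, h2⟩

/-- A word that consists of committed prefixes, and has a representative of every committed trace
as a prefix, is a linearization. -/
theorem isLinearization_of_word {W : ℕ → Option (Command n O)}
    (hcom : ∀ r t, α.Commits r t → ∃ p, Trace.mk p = t ∧ IsWordPrefix p W)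
    (hW : ∀ m m' c c', W m = some c → W m' = some c' → ∃ r p, α.Commits r (Trace.mk p) ∧
      IsWordPrefix p W ∧ m < p.length ∧ m' < p.length)
    {τ : Command n O → ℕ} (hτ : ∀ c x, α.hist.InvokesAt c x → α.hist.InvokesAt c (τ c))
    {L : Stream'.Seq (ℕ × R)} (hL : ∀ m, L.get? m = (W m).map fun c =>
      (τ c, (A.step c.op ((A.onCommands n).states W m)).1)) :
    α.hist.IsLinearization A L := by
  refine History.isLinearization_of_word hL (fun m c hc => ?_) (fun m m' c hm hm' => ?_)
    fun x k v h => ?_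
  · obtain ⟨r, p, hp, hpW, hm, -⟩ := hW m m c c hc hc
    rw [hpW m hm] at hc
    obtain ⟨x, hx⟩ := (α.proper_of_commits hp).1 c (List.mem_of_getElem? hc)
    exact hτ c x hx
  · obtain ⟨r, p, hp, hpW, hl, hl'⟩ := hW m m' c c hm hm'
    rw [hpW m hl] at hm
    rw [hpW m' hl'] at hm'
    exact (List.nodup_iff_injective_get.mp (α.proper_of_commits hp).2).eq_iff
      (a := ⟨m, hl⟩) (b := ⟨m', hl'⟩) |>.mp (by
        rw [List.getElem?_eq_getElem hl, Option.some.injEq] at hm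
        rw [List.getElem?_eq_getElem hl', Option.some.injEq] at hm'
        simp [hm, hm']) |> Fin.mk.inj
  · obtain ⟨c, r, t, hinv, ht, hct, ⟨s, hs, hret⟩, hbefore⟩ :=
      α.exists_commits_of_completesAt h
    obtain ⟨p, rfl, hp⟩ := hcom r t ht
    exact ⟨p, c, hp, hinv, hret.of_schedEquiv (Trace.mk_eq_mk.mp hs), hbefore⟩

theorem linearizable : α.hist.Linearizable A := by
  classical
  obtain ⟨l, hmono, hcom, hlast⟩ := Trace.exists_chain (K := α.Commits) α.not_commits_zero
    fun r r' t t' => α.commits_le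
  have hget : ∀ {r r' m}, m < (l r).length → r ≤ r' → (l r')[m]? = (l r)[m]? := by
    intro r r' m hm hr
    obtain ⟨z, hz⟩ := hmono r r' hr
    rw [← hz, List.getElem?_append_left hm]
  -- The limit of the chain: any `l r` that is long enough gives the same letter.
  let W : ℕ → Option (Command n O) := fun m =>
    if h : ∃ r, m < (l r).length then (l h.choose)[m]? else none
  have hW : ∀ r, IsWordPrefix (l r) W := by
    intro r m hm
    have hex : ∃ r, m < (l r).length := ⟨r, hm⟩
    simp only [W, dif_pos hex]
    rcases le_total r hex.choose with h | h
    · exact hget hm h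
    · exact (hget hex.choose_spec h).symm
  have hlen : ∀ m c, W m = some c → ∃ r, m < (l r).length := by
    intro m c h
    by_contra hex
    simp [W, dif_neg hex] at h
  obtain ⟨τ, hτ⟩ := α.hist.exists_time
  refine ⟨⟨fun m => (W m).map fun c =>
    (τ c, (A.step c.op ((A.onCommands n).states W m)).1), fun {m} hm => ?_⟩,
    α.isLinearization_of_word (fun r t ht => ⟨l r, hcom r t ht, hW r⟩)
      (fun m m' c c' hm hm' => ?_) hτ fun m => rfl⟩
  · have hm' : W m = none := Option.map_eq_none_iff.mp hm
    refine Option.map_eq_none_iff.mpr ?_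
    by_contra hne
    obtain ⟨c, hc⟩ := Option.ne_none_iff_exists'.mp hne
    obtain ⟨r, hr⟩ := hlen _ c hc
    rw [hW r m (by omega), List.getElem?_eq_none_iff] at hm'
    omega
  · obtain ⟨r, hr⟩ := hlen m c hm
    obtain ⟨r', hr'⟩ := hlen m' c' hm'
    have h1 := (hmono r (max r r') (le_max_left _ _)).length_le
    have h2 := (hmono r' (max r r') (le_max_right _ _)).length_le
    -- Both positions lie in `l (max r r')`. This list is nonempty, hence it represents a committed
    -- trace.
    rcases hlast (max r r') with ⟨r'', -, hc, -⟩ | ⟨-, hnil⟩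
    · exact ⟨r'', l (max r r'), hc, hW _, by omega, by omega⟩
    · rw [hnil] at h1
      simp at h1
      simp [h1] at hr

/-- The execution that stops at time `k`. -/
def truncate (k : ℕ) : Execution A n where
  conf m := α.conf (min m k)
  hist := α.hist.upTo k
  init := by simpa using α.init
  step m := by
    by_cases h : m < k
    · rw [min_eq_left h.le, min_eq_left (Nat.succ_le_of_lt h), History.upTo, if_pos h]
      exact α.step m
    · right
      rw [min_eq_right (by omega), min_eq_right (by omega)]
      exact ⟨if_neg h, rfl⟩
  gcaSpec m := α.gcaSpec (min m k)

/-- Translates facts about commits at any time into facts about the configuration at time `k`, where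
the truncated execution stays. -/
theorem commits_truncate {k r : ℕ} {t : CTrace A n} :
    (α.truncate k).Commits r t ↔ (α.conf k).Committed r t :=
  ⟨fun ⟨m, h⟩ => α.committed_mono (min_le_right m k) h,
    fun h => ⟨k, by simpa [truncate] using h⟩⟩

/-- The chain is cut at a bound `b` for the rounds in use, so that `l b` extends the representatives
of all committed traces. -/
theorem exists_lastCommitted (k : ℕ) : ∃ s : List (Command n O),
    (α.conf k).LastCommitted (Trace.mk s) ∧
    ∀ r t, (α.conf k).Committed r t → ∃ p, Trace.mk p = t ∧ p <+: s := by
  obtain ⟨l, hmono, hcom, hlast⟩ := Trace.exists_chain (K := (α.truncate k).Commits)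
    (α.truncate k).not_commits_zero fun r r' t t' => (α.truncate k).commits_le
  simp only [commits_truncate] at hcom hlast
  obtain ⟨b, hb⟩ := α.exists_gca_eq_nil k
  have hle : ∀ r t, (α.conf k).Committed r t → r ≤ b := by
    rintro r t ⟨p, hp, -⟩
    by_contra hlt
    simp [hb r (by omega)] at hp
  refine ⟨l b, ?_, fun r t ht => ⟨l r, hcom r t ht, hmono r b (hle r t ht)⟩⟩
  rcases hlast b with ⟨r, -, hr, hmax⟩ | ⟨hno, hnil⟩
  · exact Or.inl ⟨r, hr, fun r' t ht => hmax r' (hle r' t ht) t ht⟩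
  · exact Or.inr ⟨fun r t ht => hno r (hle r t ht) t ht, by rw [hnil]; rfl⟩

theorem exists_isLinearization_upTo (k : ℕ) :
    ∃ (s : List (Command n O)) (L : List (ℕ × R)),
      (α.conf k).LastCommitted (Trace.mk s) ∧
      List.Forall₂ (fun c p => (α.hist.upTo k).InvokesAt c p.1 ∧
        SchedRet (A.onCommands n) s c p.2) s L ∧
      (α.hist.upTo k).IsLinearization A (Stream'.Seq.ofList L) := by
  obtain ⟨s, hlast, hpre⟩ := α.exists_lastCommitted k
  have hs : s = [] ∨ ∃ r, (α.truncate k).Commits r (Trace.mk s) := by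
    rcases hlast with ⟨r, hr, -⟩ | ⟨-, he⟩
    · exact Or.inr ⟨r, α.commits_truncate.mpr hr⟩
    · left
      simpa [Trace.ops_mk, Trace.ops_empty] using congrArg Trace.ops he
  have hproper : (∀ c ∈ s, ∃ x, (α.hist.upTo k).InvokesAt c x) ∧ s.Nodup := by
    rcases hs with rfl | ⟨r, hr⟩
    · simp
    · exact (α.truncate k).proper_of_commits hr
  obtain ⟨τ, hτ⟩ := (α.hist.upTo k).exists_time
  refine ⟨s, s.mapIdx fun m c =>
    (τ c, (A.step c.op ((A.onCommands n).states (fun m => s[m]?) m)).1), hlast, ?_, ?_⟩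
  · rw [List.forall₂_iff_get]
    refine ⟨by simp, fun m hm hm' => ?_⟩
    simp only [List.get_eq_getElem, List.getElem_mapIdx]
    obtain ⟨x, hx⟩ := hproper.1 s[m] (List.getElem_mem hm)
    exact ⟨hτ _ x hx, hproper.2.schedRet (List.getElem?_eq_getElem hm)⟩
  -- The finite word `s` plays the role of the limit word: all committed traces have a prefix of `s`
  -- as representative, and `s` itself is empty or represents a committed trace.
  · refine (α.truncate k).isLinearization_of_word (W := fun m => s[m]?) (fun r t ht => ?_)
      (fun m m' c c' hm hm' => ?_) hτ fun m => ?_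
    · obtain ⟨p, hp, z, rfl⟩ := hpre r t (α.commits_truncate.mp ht)
      exact ⟨p, hp, fun m hm => List.getElem?_append_left hm⟩
    · rcases hs with rfl | ⟨r, hr⟩
      · simp at hm
      · exact ⟨r, s, hr, fun _ _ => rfl, (List.getElem?_eq_some_iff.mp hm).1,
          (List.getElem?_eq_some_iff.mp hm').1⟩
    · rw [Stream'.Seq.ofList_get?, List.getElem?_mapIdx]

end UC.Execution

theorem mainTheorem2 {O : Type u} {Q : Type v} {R : Type w} (A : SeqObject O Q R) (n : ℕ)
    (α : UC.Execution A n) :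
    α.hist.Linearizable A ∧
    ∀ k, ∃ (s : List (Command n O)) (L : List (ℕ × R)),
      (α.conf k).LastCommitted (Trace.mk s) ∧
      List.Forall₂ (fun c p => (α.hist.upTo k).InvokesAt c p.1 ∧
        SchedRet (A.onCommands n) s c p.2) s L ∧
      (α.hist.upTo k).IsLinearization A (Stream'.Seq.ofList L) :=
  ⟨α.linearizable, α.exists_isLinearization_upTo⟩
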